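/- Let $R$ be a reduced crystallographic root system with base $\Delta$ (for instance the root system of a complex simple Lie group $G$ with a Borel subgroup $B$), $R^+$ its positive roots, $W$ its Weyl group, $Q^\vee$ its coroot lattice and $2\rho=\sum_{\gamma\in R^+}\gamma$. For $\alpha_i\in\Delta$ let $s_i$ be the simple reflection and $\chi_i$ the fundamental weight; for $\gamma\in R^+$ let $s_\gamma$ be the reflection and $\gamma^\vee$ the coroot. Let $\ell$ be the length function on $W$ with respect to the simple reflections. For $I\subset\Delta$ let $W_I\subset W$ be the subgroup generated by the simple reflections in $I$, $\omega_I$ its longest element, $Q_I^\vee=\bigoplus_{\alpha\in I}\mathbb Z\alpha^\vee$, and $R_I^+=R^+\cap\bigoplus_{\alpha\in I}\mathbb Z\alpha$. For $I\subset J\subset\Delta$ let $W_J^I$ be the set of those $w\in W_J$ that have minimal length in $wW_I$. Each class in $Q^\vee/Q_I^\vee$ has a unique representative $\lambda$ with $\langle\beta,\lambda\rangle\in\{0,-1\}$ for all $\beta\in R_I^+$; call it the $I$-lift of the class. Let $(\alpha_1,\dots,\alpha_r)$ be any sequence of distinct simple roots (an ordered subset $\Delta_P$ of $\Delta$). Put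 $\Delta_j=\{\alpha_1,\dots,\alpha_j\}$ for $0\le j\le r$ and $\Delta_{r+1}=\Delta$, and let $\mathbf e_1,\dots,\mathbf e_{r+1}$ be the standard basis of $\mathbb Z^{r+1}$, which is ordered lexicographically. The grading map $gr:W\times Q^\vee\to\mathbb Z^{r+1}$, $(w,\lambda)\mapsto gr(q_\lambda w)$, is defined as follows. 1. Every $w\in W$ has a unique decomposition $w=v_{r+1}\cdots v_1$ with $v_j\in W_{\Delta_j}^{\Delta_{j-1}}$; put $gr(w)=\sum_{j=1}^{r+1}\ell(v_j)\mathbf e_j$. 2. For $\alpha\in\Delta_{j+1}\setminus\Delta_j$, $0\le j\le r$, let $\lambda'=\alpha^\vee+\sum_{i=1}^j a_i\alpha_i^\vee$ be the $\Delta_j$-lift of $\alpha^\vee+Q_{\Delta_j}^\vee$, let $\Delta_j'=\{\beta\in\Delta_j:\langle\beta,\lambda'\rangle=0\}$ and $x=\omega_{\Delta_j}\omega_{\Delta_j'}$, and put, recursively, $$gr(q_{\alpha^\vee})=\Big(\ell(x)+2+\sum_{i=1}^j2a_i\Big)\mathbf e_{j+1}-gr(x)-\sum_{i=1}^ja_i\,gr(q_{\alpha_i^\vee})$$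 (so $gr(q_{\alpha^\vee})=2\mathbf e_1$ if $j=0$). 3. For $\lambda=\sum_{\alpha\in\Delta}b_\alpha\alpha^\vee$ put $gr(q_\lambda w)=gr(w)+\sum_{\alpha\in\Delta}b_\alpha\,gr(q_{\alpha^\vee})$. **Key Lemma.** Let $u\in W$ and $\gamma\in R^+$, and let $\alpha_i\in\Delta$ be a simple root with $\langle\chi_i,\gamma^\vee\rangle\ne0$. (a) If $\ell(us_\gamma)=\ell(u)+1$, then $gr(us_\gamma)\le gr(u)+gr(s_i)$. (b) If $\ell(us_\gamma)=\ell(u)+1-\langle2\rho,\gamma^\vee\rangle$, then $gr(q_{\gamma^\vee}us_\gamma)\le gr(u)+gr(s_i)$. -/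

import Mathlib

namespace WeylGrading

noncomputable section

variable {ι K M N : Type*} [Field K] [CharZero K]
  [AddCommGroup M] [Module K M] [AddCommGroup N] [Module K N]
  {P : RootPairing ι K M N} (b : P.Base)

/-- The reflection `s_γ` in the root with index `γ`, as an element of the Weyl group. -/
abbrev refl (P : RootPairing ι K M N) (γ : ι) : P.weylGroup :=
  RootPairing.weylGroup.ofIdx P γ

/-- The length `ℓ(w)`: the least number of factors in an expression of `w` as a product of
simple reflections. -/
def length (w : P.weylGroup) : ℕ :=
  sInf {k : ℕ | ∃ l : List b.support, l.length = k ∧ (l.map fun i => refl P (i : ι)).prod = w}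

/-- The coroot lattice `Q^∨`. -/
abbrev CorootLattice (P : RootPairing ι K M N) : Submodule ℤ N := P.corootSpan ℤ

/-- The simple coroots, as a `ℤ`-basis of `Q^∨`. -/
def corootBasis : Module.Basis b.support ℤ (CorootLattice P) :=
  b.flip.toWeightBasisInt

theorem corootBasis_apply (i : b.support) : (corootBasis b i : N) = P.coroot i :=
  b.flip.coe_toWeightBasisInt_apply i

/-- The coroot `γ^∨` as an element of `Q^∨`. -/
abbrev corootElt (P : RootPairing ι K M N) (γ : ι) : CorootLattice P := P.corootSpanMem ℤ γ

/-- The pairing `⟨x, y⟩` between the weight space and the coweight space. -/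
abbrev pair (P : RootPairing ι K M N) (x : M) (y : N) : K := P.toLinearMap x y

/-- The fundamental weight `χ_i`. -/
def fundamentalWeight [P.IsRootSystem] (i : b.support) : M :=
  P.toLinearMap.toPerfPair.symm (b.toCoweightBasis.coord i)

theorem pair_fundamentalWeight [P.IsRootSystem] [DecidableEq b.support] (i j : b.support) :
    pair P (fundamentalWeight b i) (P.coroot j) = if i = j then 1 else 0 := by
  have h : P.coroot j = b.toCoweightBasis j := (b.toCoweightBasis_apply j).symm
  rw [pair, fundamentalWeight, LinearMap.apply_symm_toPerfPair_self, h,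
    Module.Basis.coord_apply, Module.Basis.repr_self, Finsupp.single_apply]
  simp only [eq_comm]

open Classical in
/-- `2ρ`, the sum of the positive roots. -/
def twoRho [Fintype ι] : M := ∑ β : ι with b.IsPos β, P.root β

/-- The subgroup `W_I` generated by the simple reflections indexed by `I`. -/
def parabolic (I : Set b.support) : Subgroup P.weylGroup :=
  Subgroup.closure ((fun i : b.support => refl P (i : ι)) '' I)

/-- The set `W_J^I` of elements of `W_J` that have minimal length in their coset
modulo `W_I`. -/
def minReps (J I : Set b.support) : Set P.weylGroup :=
  {w | w ∈ parabolic b J ∧ ∀ y ∈ parabolic b I, length b w ≤ length b (w * y)}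

/-- The longest element `ω_I` of `W_I`. -/
def longest (I : Set b.support) : P.weylGroup :=
  Classical.epsilon fun w =>
    w ∈ parabolic b I ∧ ∀ v ∈ parabolic b I, length b v ≤ length b w

/-- The sublattice `Q_I^∨` of `Q^∨` spanned by the simple coroots indexed by `I`. -/
def subLattice (I : Set b.support) : Submodule ℤ (CorootLattice P) :=
  Submodule.span ℤ (corootBasis b '' I)

/-- The set (of indices) of positive roots in the integral span of the simple roots
indexed by `I`. -/
def posRoots (I : Set b.support) : Set ι :=
  {β | b.IsPos β ∧
    P.root β ∈ Submodule.span ℤ ((fun i : b.support => P.root (i : ι)) '' I)}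

/-- The unique element `x` of `Q^∨` in a given class modulo `Q_I^∨` such that
`⟨β, x⟩ ∈ {0, -1}` for all positive roots `β` in the span of `I`. -/
def lift (I : Set b.support) (c : CorootLattice P ⧸ subLattice b I) : CorootLattice P :=
  Classical.epsilon fun x =>
    Submodule.Quotient.mk x = c ∧
      ∀ β ∈ posRoots b I, pair P (P.root β) (x : N) = 0 ∨ pair P (P.root β) (x : N) = -1

/-- `{α ∈ I | ⟨α, x⟩ = 0}`. -/
def orthogonal (I : Set b.support) (x : CorootLattice P) : Set b.support :=
  {i | i ∈ I ∧ pair P (P.root i) (x : N) = 0}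

/-- The Peterson--Woodward lifting `(v, c) ↦ (v ω_I ω_{I'}, x)`, where `x` lifts `c` and
`I' = {α ∈ I | ⟨α, x⟩ = 0}`. For `I ⊆ J`, its restriction to `W_J^I × Q_J^∨/Q_I^∨` is
the lifting of the pair `(J, I)`. -/
def pwLifting (I : Set b.support) (v : P.weylGroup) (c : CorootLattice P ⧸ subLattice b I) :
    P.weylGroup × CorootLattice P :=
  (v * longest b I * longest b (orthogonal b I (lift b I c)), lift b I c)

variable {b} {r : ℕ} (a : Fin r ↪ b.support)

/- Below, `a` is an ordered set `(α_1, …, α_r)` of simple roots; `α_k` is `a` at index `k - 1`,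
and the basis vector `e_k` of `ℤ^(r+1)` is the one at index `k - 1`. -/

/-- `Δ_j = {α_1, …, α_j}` for `j ≤ r`, and `Δ_j = Δ` for `j > r`. -/
def chain (j : ℕ) : Set b.support :=
  {i | r < j ∨ ∃ k : Fin r, (k : ℕ) < j ∧ a k = i}

/-- `w = v_{r+1} ⋯ v_1` with `v_k ∈ W_{P_k}^{P_{k-1}}`, where `P_k` belongs to `Δ_k`. -/
def IsDecomposition (w : P.weylGroup) (v : Fin (r + 1) → P.weylGroup) : Prop :=
  (∀ k : Fin (r + 1), v k ∈ minReps b (chain a (k + 1)) (chain a k)) ∧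
    (List.ofFn v).reverse.prod = w

/-- The decomposition of `w` associated to `(α_1, …, α_r)`. -/
def decomposition (w : P.weylGroup) : Fin (r + 1) → P.weylGroup :=
  Classical.epsilon (IsDecomposition a w)

/-- `gr(w) = ∑ ℓ(v_k) e_k`. -/
def grW (w : P.weylGroup) : Fin (r + 1) → ℤ :=
  fun k => (length b (decomposition a w k) : ℤ)

open Classical in
/-- The `j` with `0 ≤ j ≤ r` and `α ∈ Δ_{j+1} \ Δ_j`. -/
def stage (α : b.support) : Fin (r + 1) :=
  if h : ∃ k : Fin r, a k = α then h.choose.castSucc else Fin.last r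

theorem stage_apply (k : Fin r) : stage a (a k) = k.castSucc := by
  have h : ∃ k' : Fin r, a k' = a k := ⟨k, rfl⟩
  rw [stage, dif_pos h, a.injective h.choose_spec]

theorem stage_spec (α : b.support) :
    α ∈ chain a ((stage a α : ℕ) + 1) ∧ α ∉ chain a (stage a α : ℕ) := by
  by_cases h : ∃ k : Fin r, a k = α
  · obtain ⟨k, rfl⟩ := h
    rw [stage_apply]
    refine ⟨Or.inr ⟨k, by simp, rfl⟩, ?_⟩
    rintro (h | ⟨k', hk', h⟩)
    · exact absurd k.isLt (by simp at h; omega)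
    · rw [a.injective h] at hk'
      simp at hk'
  · rw [stage, dif_neg h]
    refine ⟨Or.inl (by simp), ?_⟩
    rintro (h' | ⟨k', _, h'⟩)
    · simp at h'
    · exact h ⟨k', h'⟩

/-- The pair `ψ_{Δ_{j+1}, Δ_j}(1, α^∨ + Q_j^∨)`, where `α ∈ Δ_{j+1} \ Δ_j`. -/
def simpleLift (α : b.support) : P.weylGroup × CorootLattice P :=
  pwLifting b (chain a (stage a α)) 1 (Submodule.Quotient.mk (corootElt P (α : ι)))

/-- The grading `gr(q_{α^∨})` of a simple root `α ∈ Δ_{j+1} \ Δ_j`, defined recursively by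
`gr(q_{α^∨}) = (ℓ(x) + 2 + ∑_{i ≤ j} 2 a_i) e_{j+1} - gr(x) - ∑_{i ≤ j} a_i gr(q_{α_i^∨})`,
where `(x, α^∨ + ∑_{i ≤ j} a_i α_i^∨) = ψ_{Δ_{j+1}, Δ_j}(1, α^∨ + Q_j^∨)`.
For `j = 0` this gives `gr(q_{α^∨}) = 2 e_1`. -/
def grQ (α : b.support) : Fin (r + 1) → ℤ :=
  ((length b (simpleLift a α).1 : ℤ) + 2
      + ∑ i : Fin (stage a α : ℕ),
          2 * (corootBasis b).repr (simpleLift a α).2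
            (a (i.castLE (Nat.lt_succ_iff.mp (stage a α).isLt)))) • Pi.single (stage a α) 1
    - grW a (simpleLift a α).1
    - ∑ i : Fin (stage a α : ℕ),
        (corootBasis b).repr (simpleLift a α).2
            (a (i.castLE (Nat.lt_succ_iff.mp (stage a α).isLt))) •
          grQ (a (i.castLE (Nat.lt_succ_iff.mp (stage a α).isLt)))
termination_by (stage a α : ℕ)
decreasing_by
  rw [stage_apply]
  exact i.isLt

/-- The grading map `gr : W × Q^∨ → ℤ^(r+1)` associated to `(α_1, …, α_r)`, with values in
`ℤ^(r+1)` ordered lexicographically; `gr a w x` is the grading of `q_x w`. -/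
def gr (w : P.weylGroup) (x : CorootLattice P) : Lex (Fin (r + 1) → ℤ) :=
  toLex (grW a w + ∑ α : b.support, (corootBasis b).repr x α • grQ a α)

end

end WeylGrading

namespace WeylGrading

noncomputable section

set_option linter.unusedSectionVars false

section

variable {ι K M N : Type*} [Fintype ι] [Field K] [CharZero K]
  [AddCommGroup M] [Module K M] [AddCommGroup N] [Module K N]
  {P : RootPairing ι K M N} (b : P.Base)

/-! ### The action of the Weyl group on roots -/

/-! For a set `I` of simple roots, `inv b I w` counts the positive roots in the span of `I` that `w`
makes negative, and `sumPos b I x` pairs `x` with the sum of those positive roots. The proof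
replaces the recursive grading by a closed formula: the partial sum of the first `m` coordinates of
`gr(q_x w)` is `inv b (chain a m) w + sumPos b (chain a m) x` (`gr_apply`).

For the Weyl group part (`grW_apply`), the factors of index beyond `m` in the decomposition of `w`
preserve the signs of roots supported on `Δ_m`, so the inversions of `w` in `Δ_m` are those of the
product of the first `m` factors, and lengths add. For the lattice part (`grQ_apply`), the recursion
is solved by the pairings with sums of positive roots: `ω_I ω_{I'}` inverts exactly the positive
roots of `I` on which the lift takes the value `-1`, so its inversion counts cancel against the
pairings of the lift.

An inequality between all partial sums implies the lexicographic one. It therefore suffices to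
prove, for every `I` and with `x = 0` in (a), `x = γ^∨` in (b), that `inv_I(u s_γ) + sumPos_I(x) ≤
inv_I(u) + inv_I(s_i)`. If `γ` lies in the span of `I`, then `α_i ∈ I`, so the last term is `1`;
moreover `s_γ` permutes the positive roots outside that span, so `inv_I` changes exactly as the
length does and equality holds. If `γ` is not in the span, the last term is not needed: the length
hypothesis is so tight that, among the positive roots made negative by `s_γ`, only `γ` contributes,
and every positive root of `I` contributes at most `0` (`inv_mul_refl_le`,
`inv_mul_refl_add_sumPos_le`).

Decompositions, lifts and longest elements are chosen by `Classical.epsilon`; only their existence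
is needed, not their uniqueness. -/

theorem root_smul (w : P.weylGroup) (β : ι) : P.root (w • β) = w • P.root β :=
  RootPairing.Equiv.root_indexEquiv_eq_smul (P := P) β (w : P.Aut)

theorem refl_smul (γ β : ι) : refl P γ • β = P.reflectionPerm γ β := rfl

theorem refl_mul_self (γ : ι) : refl P γ * refl P γ = 1 := by
  have h : (refl P γ)⁻¹ = refl P γ := Subtype.ext (RootPairing.Equiv.reflection_inv P γ)
  nth_rewrite 1 [← h]
  exact inv_mul_cancel _

theorem refl_smul_refl_smul (γ β : ι) : refl P γ • refl P γ • β = β := by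
  rw [smul_smul, refl_mul_self, one_smul]

theorem root_refl_self_smul (β : ι) : P.root (refl P β • β) = -P.root β := by
  simp [refl_smul]

theorem smul_refl_self_smul (w : P.weylGroup) (β : ι) :
    w • refl P β • β = refl P (w • β) • w • β := by
  apply P.root.injective
  rw [root_smul, root_refl_self_smul, root_refl_self_smul, root_smul, smul_neg]

theorem weylGroup_ext {v w : P.weylGroup} (h : ∀ x : M, v • x = w • x) : v = w :=
  Subtype.ext (RootPairing.Equiv.weightHom_injective P (LinearEquiv.ext h))

theorem refl_smul_eq_conj (w : P.weylGroup) (γ : ι) :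
    refl P (w • γ) = w * refl P γ * w⁻¹ := by
  suffices h : ∀ (w : P.Aut) (hw : w ∈ P.weylGroup) (γ : ι),
      refl P ((⟨w, hw⟩ : P.weylGroup) • γ) = ⟨w, hw⟩ * refl P γ * (⟨w, hw⟩ : P.weylGroup)⁻¹ from
    h w w.2 γ
  intro w hw
  induction hw using RootPairing.weylGroup.induction with
  | mem j =>
    intro γ
    have h : (refl P j)⁻¹ = refl P j := Subtype.ext (RootPairing.Equiv.reflection_inv P j)
    change refl P (refl P j • γ) = refl P j * refl P γ * (refl P j)⁻¹
    rw [h]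
    refine weylGroup_ext fun x => ?_
    exact LinearEquiv.congr_fun (P.reflection_reflectionPerm (i := γ) (j := j)) x
  | one => intro γ; change refl P ((1 : P.weylGroup) • γ) = 1 * refl P γ * 1⁻¹; simp
  | mul v w hv hw ihv ihw =>
    intro γ
    change refl P (((⟨v, hv⟩ : P.weylGroup) * ⟨w, hw⟩) • γ) =
      (⟨v, hv⟩ * ⟨w, hw⟩) * refl P γ * ((⟨v, hv⟩ : P.weylGroup) * ⟨w, hw⟩)⁻¹
    rw [mul_smul, ihv, ihw]
    group

section Crystallographic

variable [P.IsCrystallographic]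

theorem root_refl_smul (γ β : ι) :
    P.root (refl P γ • β) = P.root β + (-P.pairingIn ℤ β γ) • P.root γ := by
  rw [refl_smul, P.root_reflectionPerm, P.reflection_apply_root' ℤ, neg_smul, sub_eq_add_neg]

end Crystallographic

theorem root_smul_of_eq_add_zsmul (w : P.weylGroup) {i j k : ι} {z : ℤ}
    (h : P.root k = P.root i + z • P.root j) :
    P.root (w • k) = P.root (w • i) + z • P.root (w • j) := by
  rw [root_smul, root_smul, root_smul, h, smul_add, smul_comm z]

/-! ### Coefficients of roots with respect to the simple roots -/

/-- The coefficient of the root `β` at the simple root `j`. -/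
def coeff (β : ι) (j : b.support) : ℤ := b.toWeightBasisInt.repr (P.rootSpanMem ℤ β) j

theorem root_eq_sum_coeff (β : ι) : P.root β = ∑ j, coeff b β j • P.root (j : ι) := by
  have h := congrArg (Subtype.val) (b.toWeightBasisInt.sum_repr (P.rootSpanMem ℤ β))
  simpa [coeff] using h.symm

theorem coeff_of_eq_add_zsmul {i j k : ι} {z : ℤ} (h : P.root k = P.root i + z • P.root j)
    (s : b.support) : coeff b k s = coeff b i s + z * coeff b j s := by
  have h' : P.rootSpanMem ℤ k = P.rootSpanMem ℤ i + z • P.rootSpanMem ℤ j := Subtype.ext h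
  rw [coeff, h', map_add, map_zsmul]
  rfl

theorem coeff_simple [DecidableEq b.support] (i j : b.support) :
    coeff b (i : ι) j = if i = j then 1 else 0 := by
  have h : P.rootSpanMem ℤ (i : ι) = b.toWeightBasisInt i := Subtype.ext (by simp)
  rw [coeff, h, Module.Basis.repr_self, Finsupp.single_apply]

theorem coeff_simple_of_ne {i j : b.support} (h : i ≠ j) : coeff b (i : ι) j = 0 := by
  classical simp [coeff_simple, h]

theorem coeff_refl_self_smul (β : ι) (s : b.support) :
    coeff b (refl P β • β) s = -coeff b β s := by
  have h : P.root (refl P β • β) = P.root β + (-2 : ℤ) • P.root β := by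
    rw [root_refl_self_smul]; module
  rw [coeff_of_eq_add_zsmul b h]; ring

theorem exists_coeff_ne_zero (β : ι) : ∃ j, coeff b β j ≠ 0 := by
  by_contra! h
  exact P.ne_zero β (by rw [root_eq_sum_coeff b]; simp [h])

theorem coeff_smul (w : P.weylGroup) (β : ι) (s : b.support) :
    coeff b (w • β) s = ∑ j, coeff b β j * coeff b (w • (j : ι)) s := by
  have h : P.rootSpanMem ℤ (w • β) = ∑ j, coeff b β j • P.rootSpanMem ℤ (w • (j : ι)) := by
    apply Subtype.ext
    rw [Submodule.coe_sum]
    change P.root (w • β) = ∑ j, coeff b β j • P.root (w • (j : ι))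
    rw [root_smul, root_eq_sum_coeff b β, Finset.smul_sum]
    exact Finset.sum_congr rfl fun j _ => by rw [root_smul, smul_comm]
  rw [coeff, h, map_sum, Finsupp.finsetSum_apply]
  exact Finset.sum_congr rfl fun j _ => by rw [map_zsmul]; rfl

theorem isPos_refl_self_smul (β : ι) : b.IsPos (refl P β • β) ↔ ¬ b.IsPos β :=
  RootPairing.Base.IsPos.neg_iff_not b β

theorem height_eq_sum_coeff (β : ι) : b.height β = ∑ j, coeff b β j := by
  classical
  let f : ι → ℤ := fun j => if h : j ∈ b.support then coeff b β ⟨j, h⟩ else 0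
  have h : P.root β = ∑ j ∈ b.support, f j • P.root j := by
    rw [root_eq_sum_coeff b β, ← Finset.sum_coe_sort b.support]
    exact Finset.sum_congr rfl fun j _ => by simp [f]
  rw [RootPairing.Base.height_eq_sum h, ← Finset.sum_coe_sort b.support]
  exact Finset.sum_congr rfl fun j _ => by simp [f]

theorem isPos_of_coeff_nonneg {β : ι} (h : ∀ j, 0 ≤ coeff b β j) : b.IsPos β := by
  rw [RootPairing.Base.isPos_iff', height_eq_sum_coeff]
  exact Finset.sum_nonneg fun j _ => h j

theorem not_isPos_of_coeff_nonpos {β : ι} (h : ∀ j, coeff b β j ≤ 0) : ¬ b.IsPos β := by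
  rw [← isPos_refl_self_smul]
  exact isPos_of_coeff_nonneg b fun j => by rw [coeff_refl_self_smul]; linarith [h j]

theorem isPos_simple (i : b.support) : b.IsPos (i : ι) :=
  RootPairing.Base.isPos_of_mem_support i.2

variable {b}

theorem isPos_of_eq_add_zsmul {i j k : ι} {z : ℤ} (h : P.root k = P.root i + z • P.root j)
    (hi : b.IsPos i) (hj : b.IsPos j) (hz : 0 ≤ z) : b.IsPos k := by
  rw [RootPairing.Base.isPos_iff] at *
  rw [b.height_add_zsmul h]
  have := mul_nonneg hz hj.le
  simp only [smul_eq_mul]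
  linarith

section Crystallographic

variable [P.IsCrystallographic]

theorem coeff_nonneg {β : ι} (h : b.IsPos β) (s : b.support) : 0 ≤ coeff b β s := by
  classical
  refine h.induction_on_add (p := fun β => 0 ≤ coeff b β s) (fun i hi => ?_)
    fun i j k hk hi hj => ?_
  · rw [coeff_simple b ⟨i, hi⟩]; split_ifs <;> simp
  · have hk' : P.root k = P.root i + (1 : ℤ) • P.root j := by rw [hk, one_smul]
    rw [coeff_of_eq_add_zsmul b hk', coeff_simple b ⟨j, hj⟩]
    split_ifs <;> omega

theorem coeff_nonpos {β : ι} (h : ¬ b.IsPos β) (s : b.support) : coeff b β s ≤ 0 := by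
  rw [← isPos_refl_self_smul] at h
  have := coeff_nonneg h s
  rw [coeff_refl_self_smul] at this
  linarith

theorem isPos_of_coeff_pos {β : ι} {s : b.support} (h : 0 < coeff b β s) : b.IsPos β := by
  by_contra h'
  linarith [coeff_nonpos h' s]

end Crystallographic

/-! ### Roots supported on a set of simple roots -/

variable (b) in
/-- The root `β` is a combination of the simple roots in `I`. -/
def SupportedOn (I : Set b.support) (β : ι) : Prop := ∀ j ∉ I, coeff b β j = 0

theorem SupportedOn.mono {I J : Set b.support} (hIJ : I ⊆ J) {β : ι} (h : SupportedOn b I β) :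
    SupportedOn b J β :=
  fun j hj => h j fun hj' => hj (hIJ hj')

theorem supportedOn_simple {I : Set b.support} {i : b.support} (hi : i ∈ I) :
    SupportedOn b I (i : ι) :=
  fun _ hj => coeff_simple_of_ne b fun h => hj (h ▸ hi)

theorem supportedOn_refl_self {I : Set b.support} {β : ι} :
    SupportedOn b I (refl P β • β) ↔ SupportedOn b I β := by
  simp [SupportedOn, coeff_refl_self_smul]

theorem supportedOn_iff_mem_span {I : Set b.support} {β : ι} :
    SupportedOn b I β ↔
      P.root β ∈ Submodule.span ℤ ((fun i : b.support => P.root (i : ι)) '' I) := by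
  have h : P.root β ∈ Submodule.span ℤ ((fun i : b.support => P.root (i : ι)) '' I) ↔
      P.rootSpanMem ℤ β ∈ Submodule.span ℤ (b.toWeightBasisInt '' I) := by
    have h' : ((fun i : b.support => P.root (i : ι)) '' I) =
        (P.rootSpan ℤ).subtype '' (b.toWeightBasisInt '' I) := by
      rw [Set.image_image]
      exact Set.image_congr fun i _ => by simp
    rw [h', ← Submodule.map_span]
    constructor
    · rintro ⟨x, hx, hx'⟩
      have : x = P.rootSpanMem ℤ β := Subtype.ext hx'
      exact this ▸ hx
    · exact fun hx => ⟨_, hx, rfl⟩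
  rw [h, Module.Basis.mem_span_image]
  constructor
  · intro hβ j hj
    by_contra hj'
    exact (Finsupp.mem_support_iff.mp hj) (hβ j hj')
  · intro hβ j hj
    by_contra hj'
    exact hj (hβ (Finsupp.mem_support_iff.mpr hj'))

open Classical in
variable (b) in
/-- The positive roots supported on `I`. -/
def posFinset (I : Set b.support) : Finset ι := {β | b.IsPos β ∧ SupportedOn b I β}

theorem mem_posFinset {I : Set b.support} {β : ι} :
    β ∈ posFinset b I ↔ b.IsPos β ∧ SupportedOn b I β := by
  simp [posFinset]

theorem mem_posRoots {I : Set b.support} {β : ι} : β ∈ posRoots b I ↔ β ∈ posFinset b I := by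
  rw [mem_posFinset, supportedOn_iff_mem_span]; rfl

theorem mem_posFinset_univ {β : ι} : β ∈ posFinset b Set.univ ↔ b.IsPos β := by
  simp [mem_posFinset, SupportedOn]

theorem posFinset_mono {I J : Set b.support} (h : I ⊆ J) : posFinset b I ⊆ posFinset b J := by
  intro β hβ
  rw [mem_posFinset] at *
  exact ⟨hβ.1, hβ.2.mono h⟩

variable [P.IsCrystallographic]

theorem supportedOn_refl_smul {I : Set b.support} {γ β : ι} (hγ : SupportedOn b I γ) :
    SupportedOn b I (refl P γ • β) ↔ SupportedOn b I β := by
  refine forall₂_congr fun j hj => ?_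
  rw [coeff_of_eq_add_zsmul b (root_refl_smul γ β), hγ j hj]
  simp

/-- At a simple root outside `I`, the coefficient of `s_γ β` is `-⟨β, γ^∨⟩` times that of `γ`;
positivity of both roots forces it to vanish. -/
theorem supportedOn_of_pairing_pos {I : Set b.support} {γ β : ι} (hγ : b.IsPos γ)
    (hβ : SupportedOn b I β) (hs : b.IsPos (refl P γ • β)) (hp : 0 < P.pairingIn ℤ β γ) :
    SupportedOn b I γ := by
  intro j hj
  have h := coeff_of_eq_add_zsmul b (root_refl_smul γ β) j
  rw [hβ j hj] at h
  have h1 := coeff_nonneg hs j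
  have h2 := coeff_nonneg hγ j
  nlinarith

section Reduced

variable [P.IsReduced] [DecidableEq ι]

theorem isPos_refl_simple_smul {i : b.support} {β : ι} (hβ : b.IsPos β) (h : β ≠ i) :
    b.IsPos (refl P (i : ι) • β) :=
  hβ.reflectionPerm i.2 h

theorem refl_simple_smul_mem {I : Set b.support} {i : b.support} (hi : i ∈ I) {β : ι}
    (hβ : β ∈ (posFinset b I).erase i) : refl P (i : ι) • β ∈ (posFinset b I).erase i := by
  rw [Finset.mem_erase, mem_posFinset] at *
  refine ⟨fun h => ?_, isPos_refl_simple_smul hβ.2.1 hβ.1,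
    (supportedOn_refl_smul (supportedOn_simple hi)).mpr hβ.2.2⟩
  have h' : refl P (i : ι) • (i : ι) = β := by
    have := refl_smul_refl_smul (P := P) (i : ι) β
    rwa [h] at this
  have h'' := hβ.2.1
  rw [← h', isPos_refl_self_smul] at h''
  exact h'' (isPos_simple b i)

theorem sum_posFinset_erase_refl_smul {A : Type*} [AddCommMonoid A] {I : Set b.support}
    {i : b.support} (hi : i ∈ I) (f : ι → A) :
    ∑ β ∈ (posFinset b I).erase i, f (refl P (i : ι) • β) = ∑ β ∈ (posFinset b I).erase i, f β :=
  Finset.sum_nbij' (refl P (i : ι) • ·) (refl P (i : ι) • ·)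
    (fun _ h => refl_simple_smul_mem hi h) (fun _ h => refl_simple_smul_mem hi h)
    (fun _ _ => refl_smul_refl_smul _ _) (fun _ _ => refl_smul_refl_smul _ _) fun _ _ => rfl

end Reduced

end

section

variable {ι K M N : Type*} [Fintype ι] [Field K] [CharZero K]
  [AddCommGroup M] [Module K M] [AddCommGroup N] [Module K N]
  {P : RootPairing ι K M N} (b : P.Base)

/-! ### Inversions and length -/

open Classical in
/-- `1` if the root `β` is negative and `0` otherwise. -/
def negInd (β : ι) : ℤ := if b.IsPos β then 0 else 1

/-- The number of positive roots supported on `I` which `w` sends to negative roots. -/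
def inv (I : Set b.support) (w : P.weylGroup) : ℤ := ∑ β ∈ posFinset b I, negInd b (w • β)

variable {b}

theorem negInd_of_isPos {β : ι} (h : b.IsPos β) : negInd b β = 0 := if_pos h

theorem negInd_of_not_isPos {β : ι} (h : ¬ b.IsPos β) : negInd b β = 1 := if_neg h

theorem negInd_nonneg (β : ι) : 0 ≤ negInd b β := by
  unfold negInd; split_ifs <;> simp

theorem negInd_le_one (β : ι) : negInd b β ≤ 1 := by
  unfold negInd; split_ifs <;> simp

theorem negInd_refl_self_smul (β : ι) : negInd b (refl P β • β) = 1 - negInd b β := by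
  by_cases h : b.IsPos β
  · rw [negInd_of_isPos h, negInd_of_not_isPos (by rwa [isPos_refl_self_smul, not_not])]; rfl
  · rw [negInd_of_not_isPos h, negInd_of_isPos (by rwa [isPos_refl_self_smul])]; rfl

theorem negInd_congr {α β : ι} (h : b.IsPos α ↔ b.IsPos β) : negInd b α = negInd b β := by
  by_cases hβ : b.IsPos β
  · rw [negInd_of_isPos hβ, negInd_of_isPos (h.mpr hβ)]
  · rw [negInd_of_not_isPos hβ, negInd_of_not_isPos (mt h.mp hβ)]

theorem negInd_smul_refl_self (w : P.weylGroup) (β : ι) :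
    negInd b (w • refl P β • β) = 1 - negInd b (w • β) := by
  rw [smul_refl_self_smul, negInd_refl_self_smul]

theorem inv_nonneg (I : Set b.support) (w : P.weylGroup) : 0 ≤ inv b I w :=
  Finset.sum_nonneg fun _ _ => negInd_nonneg _

theorem inv_one (I : Set b.support) : inv b I 1 = 0 :=
  Finset.sum_eq_zero fun β hβ => by rw [one_smul, negInd_of_isPos (mem_posFinset.mp hβ).1]

theorem inv_eq_zero_of_isPos {I : Set b.support} {w : P.weylGroup}
    (h : ∀ β ∈ posFinset b I, b.IsPos (w • β)) : inv b I w = 0 :=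
  Finset.sum_eq_zero fun β hβ => negInd_of_isPos (h β hβ)

variable [P.IsCrystallographic] [P.IsReduced]

theorem simple_mem_posFinset {I : Set b.support} {i : b.support} (hi : i ∈ I) :
    (i : ι) ∈ posFinset b I :=
  mem_posFinset.mpr ⟨isPos_simple b i, supportedOn_simple hi⟩

/-- `s_i` permutes the positive roots of `I` other than `α_i`, so only the term of `α_i` changes,
and it flips. -/
theorem inv_mul_refl_simple {I : Set b.support} {i : b.support} (hi : i ∈ I) (w : P.weylGroup) :
    inv b I (w * refl P (i : ι)) = inv b I w + 1 - 2 * negInd b (w • (i : ι)) := by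
  classical
  have h := sum_posFinset_erase_refl_smul hi fun β => negInd b (w • β)
  have h1 := Finset.add_sum_erase (posFinset b I) (fun β => negInd b (w • β))
    (simple_mem_posFinset hi)
  have h2 := Finset.add_sum_erase (posFinset b I) (fun β => negInd b (w • refl P (i : ι) • β))
    (simple_mem_posFinset hi)
  simp only [negInd_smul_refl_self] at h2
  simp only [inv, mul_smul]
  linarith

/-- The product of the simple reflections in a list. -/
abbrev wordProd (l : List b.support) : P.weylGroup := (l.map fun i : b.support => refl P (i : ι)).prod

theorem length_eq_sInf (w : P.weylGroup) :
    length b w = sInf {k : ℕ | ∃ l : List b.support, l.length = k ∧ wordProd l = w} := by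
  simp [length, wordProd]

theorem inv_wordProd_le (l : List b.support) : inv b Set.univ (wordProd l) ≤ l.length := by
  induction l using List.reverseRecOn with
  | nil => simp [wordProd, inv_one]
  | append_singleton l i ih =>
    have h := inv_mul_refl_simple (Set.mem_univ i) (wordProd l)
    have h' := negInd_nonneg (b := b) (wordProd l • (i : ι))
    have hl : wordProd (l ++ [i]) = wordProd l * refl P (i : ι) := by simp [wordProd]
    rw [hl, h]
    push_cast [List.length_append, List.length_singleton]
    linarith

/-- The exchange condition: some letter turns the successive images of `α_i` from positive to
negative, and deleting that letter has the effect of multiplying by `s_i`. -/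
theorem exists_wordProd_eq_mul_refl (l : List b.support) (i : b.support)
    (h : ¬ b.IsPos (wordProd l • (i : ι))) :
    ∃ l' : List b.support, l'.length + 1 = l.length ∧ wordProd l' = wordProd l * refl P (i : ι) := by
  induction l with
  | nil => exact absurd (isPos_simple b i) (by simpa [wordProd] using h)
  | cons j t ih =>
    have hjt : wordProd (j :: t) = refl P (j : ι) * wordProd t := by simp [wordProd]
    by_cases ht : b.IsPos (wordProd t • (i : ι))
    · classical
      rw [hjt, mul_smul] at h
      -- The only positive root made negative by `s_j` is `α_j`. Conjugation then gives `s_j = t s_i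
      -- t⁻¹`, hence `s_j t s_i = t`.
      have hij : wordProd t • (i : ι) = (j : ι) := by
        by_contra hne
        classical exact h (isPos_refl_simple_smul ht hne)
      refine ⟨t, rfl, ?_⟩
      rw [hjt, ← hij, refl_smul_eq_conj]
      simp [mul_assoc, refl_mul_self]
    · obtain ⟨l', hl', hl⟩ := ih ht
      refine ⟨j :: l', by simp [hl'], ?_⟩
      rw [hjt, mul_assoc, ← hl]
      simp [wordProd]

theorem exists_wordProd_length_eq_inv (l : List b.support) :
    ∃ l' : List b.support, (l'.length : ℤ) = inv b Set.univ (wordProd l) ∧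
      wordProd l' = wordProd l := by
  induction l using List.reverseRecOn with
  | nil => exact ⟨[], by simp [wordProd, inv_one], rfl⟩
  | append_singleton l i ih =>
    obtain ⟨l', hl, hl'⟩ := ih
    have hli (m : List b.support) : wordProd (m ++ [i]) = wordProd m * refl P (i : ι) := by
      simp [wordProd]
    have h := inv_mul_refl_simple (Set.mem_univ i) (wordProd l)
    by_cases hp : b.IsPos (wordProd l • (i : ι))
    · refine ⟨l' ++ [i], ?_, by rw [hli, hli, hl']⟩
      rw [hli, h, negInd_of_isPos hp, ← hl]
      simp
    · obtain ⟨l'', h1, h2⟩ := exists_wordProd_eq_mul_refl l' i (by rwa [hl'])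
      refine ⟨l'', ?_, by rw [hli, h2, hl']⟩
      rw [hli, h, negInd_of_not_isPos hp, ← hl, ← h1]
      push_cast
      ring

theorem exists_wordProd_eq (w : P.weylGroup) : ∃ l : List b.support, wordProd l = w := by
  have hone : ∃ l : List b.support, wordProd l = (1 : P.weylGroup) := ⟨[], rfl⟩
  have hmul (v w : P.weylGroup) : (∃ l : List b.support, wordProd l = v) →
      (∃ l : List b.support, wordProd l = w) → ∃ l : List b.support, wordProd l = v * w := by
    rintro ⟨l, rfl⟩ ⟨m, rfl⟩
    exact ⟨l ++ m, by simp [wordProd]⟩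
  have hrefl (γ : ι) : ∃ l : List b.support, wordProd l = refl P γ := by
    refine b.induction_reflect γ
      (p := fun γ => ∃ l : List b.support, wordProd l = refl P γ) (fun β hβ => ?_) (fun i hi => ⟨[⟨i, hi⟩], by simp [wordProd]⟩)
      fun β j hβ hj => ?_
    · change ∃ l : List b.support, wordProd l = refl P (refl P β • β)
      rw [refl_smul_eq_conj, mul_inv_cancel_right]
      exact hβ
    · change ∃ l : List b.support, wordProd l = refl P (refl P j • β)
      rw [refl_smul_eq_conj, inv_eq_of_mul_eq_one_left (refl_mul_self j)]
      have hj' : ∃ l : List b.support, wordProd l = refl P j := ⟨[⟨j, hj⟩], by simp [wordProd]⟩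
      exact hmul _ _ (hmul _ _ hj' hβ) hj'
  obtain ⟨w, hw⟩ := w
  induction hw using RootPairing.weylGroup.induction with
  | mem i => exact hrefl i
  | one => exact hone
  | mul v w hv hw ihv ihw => exact hmul ⟨v, hv⟩ ⟨w, hw⟩ ihv ihw

/-- Each letter adds at most one inversion, and by the exchange condition any word can be shortened
until its length equals the number of inversions. -/
theorem length_eq_inv (w : P.weylGroup) : (length b w : ℤ) = inv b Set.univ w := by
  obtain ⟨l, rfl⟩ := exists_wordProd_eq (b := b) w
  obtain ⟨l', hl', h⟩ := exists_wordProd_length_eq_inv l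
  rw [length_eq_sInf]
  apply le_antisymm
  · have h' : sInf {k : ℕ | ∃ m : List b.support, m.length = k ∧ wordProd m = wordProd l} ≤
        l'.length := Nat.sInf_le ⟨l', rfl, h⟩
    rw [← hl']
    exact_mod_cast h'
  · obtain ⟨m, hm, hml⟩ := Nat.sInf_mem
      (s := {k : ℕ | ∃ m : List b.support, m.length = k ∧ wordProd m = wordProd l}) ⟨_, l, rfl, rfl⟩
    rw [← hm, ← hml]
    exact inv_wordProd_le m

theorem parabolic_univ : parabolic b Set.univ = ⊤ := by
  refine (Subgroup.eq_top_iff' _).mpr fun w => ?_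
  obtain ⟨l, rfl⟩ := exists_wordProd_eq (b := b) w
  refine Subgroup.list_prod_mem _ fun x hx => ?_
  obtain ⟨i, -, rfl⟩ := List.mem_map.mp hx
  exact Subgroup.subset_closure ⟨i, trivial, rfl⟩

/-! ### Parabolic subgroups -/

theorem refl_mem_parabolic {I : Set b.support} {i : b.support} (hi : i ∈ I) :
    refl P (i : ι) ∈ parabolic b I :=
  Subgroup.subset_closure ⟨i, hi, rfl⟩

theorem parabolic_mono {I J : Set b.support} (h : I ⊆ J) : parabolic b I ≤ parabolic b J :=
  Subgroup.closure_mono (Set.image_mono h)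

theorem parabolic_empty : parabolic b ∅ = ⊥ := by
  simp [parabolic]

theorem coeff_smul_of_mem_parabolic {I : Set b.support} {w : P.weylGroup} (hw : w ∈ parabolic b I)
    (β : ι) {j : b.support} (hj : j ∉ I) : coeff b (w • β) j = coeff b β j := by
  induction hw using Subgroup.closure_induction generalizing β with
  | mem w hw =>
    obtain ⟨i, hi, rfl⟩ := hw
    rw [coeff_of_eq_add_zsmul b (root_refl_smul _ β),
      coeff_simple_of_ne b (i := i) (j := j) fun h => hj (h ▸ hi)]
    ring
  | one => rw [one_smul]
  | mul v w _ _ hv hw => rw [mul_smul, hv, hw]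
  | inv w _ hw => rw [← hw (w⁻¹ • β), smul_inv_smul]

theorem supportedOn_smul_iff {I : Set b.support} {w : P.weylGroup} (hw : w ∈ parabolic b I)
    {β : ι} : SupportedOn b I (w • β) ↔ SupportedOn b I β :=
  forall₂_congr fun j hj => by rw [coeff_smul_of_mem_parabolic hw β hj]

theorem isPos_smul_of_not_supportedOn {I : Set b.support} {w : P.weylGroup}
    (hw : w ∈ parabolic b I) {β : ι} (hβ : b.IsPos β) (hI : ¬ SupportedOn b I β) :
    b.IsPos (w • β) := by
  obtain ⟨j, hj, hne⟩ : ∃ j, j ∉ I ∧ coeff b β j ≠ 0 := by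
    simpa [SupportedOn] using hI
  refine isPos_of_coeff_pos (s := j) ?_
  rw [coeff_smul_of_mem_parabolic hw β hj]
  exact lt_of_le_of_ne (coeff_nonneg hβ j) hne.symm

theorem posFinset_sdiff_smul_mem [DecidableEq ι] {I J : Set b.support} (hIJ : I ⊆ J)
    {w : P.weylGroup} (hw : w ∈ parabolic b I) {β : ι}
    (hβ : β ∈ posFinset b J \ posFinset b I) : w • β ∈ posFinset b J \ posFinset b I := by
  simp only [Finset.mem_sdiff, mem_posFinset, not_and] at *
  have h := hβ.2 hβ.1.1
  exact ⟨⟨isPos_smul_of_not_supportedOn hw hβ.1.1 h,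
    (supportedOn_smul_iff (parabolic_mono hIJ hw)).mpr hβ.1.2⟩,
    fun _ => mt (supportedOn_smul_iff hw).mp h⟩

theorem sum_posFinset_sdiff_smul [DecidableEq ι] {A : Type*} [AddCommMonoid A]
    {I J : Set b.support} (hIJ : I ⊆ J) {w : P.weylGroup} (hw : w ∈ parabolic b I) (f : ι → A) :
    ∑ β ∈ posFinset b J \ posFinset b I, f (w • β) = ∑ β ∈ posFinset b J \ posFinset b I, f β :=
  Finset.sum_nbij' (w • ·) (w⁻¹ • ·) (fun _ h => posFinset_sdiff_smul_mem hIJ hw h)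
    (fun _ h => posFinset_sdiff_smul_mem hIJ (inv_mem hw) h)
    (fun _ _ => inv_smul_smul _ _) (fun _ _ => smul_inv_smul _ _) fun _ _ => rfl

/-- An element which is positive on the simple roots in `I` preserves the sign of every root
supported on `I`. -/
theorem isPos_smul_of_forall_simple {I : Set b.support} {w : P.weylGroup}
    (h : ∀ i ∈ I, b.IsPos (w • (i : ι))) {β : ι} (hβ : SupportedOn b I β) :
    b.IsPos (w • β) ↔ b.IsPos β := by
  have key {β : ι} (hβ : SupportedOn b I β) (hp : b.IsPos β) : b.IsPos (w • β) := by
    refine isPos_of_coeff_nonneg b fun s => ?_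
    rw [coeff_smul]
    refine Finset.sum_nonneg fun j _ => ?_
    by_cases hj : j ∈ I
    · exact mul_nonneg (coeff_nonneg hp j) (coeff_nonneg (h j hj) s)
    · rw [hβ j hj, zero_mul]
  refine ⟨fun hw => ?_, key hβ⟩
  by_contra hp
  -- The converse is the direct implication applied to `-β`.
  have h' := key (supportedOn_refl_self.mpr hβ) ((isPos_refl_self_smul b β).mpr hp)
  rw [smul_refl_self_smul, isPos_refl_self_smul] at h'
  exact h' hw

theorem not_isPos_smul_of_forall_simple {I : Set b.support} {w : P.weylGroup}
    (h : ∀ i ∈ I, ¬ b.IsPos (w • (i : ι))) {β : ι} (hβ : β ∈ posFinset b I) :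
    ¬ b.IsPos (w • β) := by
  rw [mem_posFinset] at hβ
  refine not_isPos_of_coeff_nonpos b fun s => ?_
  rw [coeff_smul]
  refine Finset.sum_nonpos fun j _ => ?_
  by_cases hj : j ∈ I
  · exact mul_nonpos_of_nonneg_of_nonpos (coeff_nonneg hβ.1 j) (coeff_nonpos (h j hj) s)
  · rw [hβ.2 j hj, zero_mul]

theorem inv_of_subset_of_mem_parabolic {I J : Set b.support} (hIJ : I ⊆ J) {w : P.weylGroup}
    (hw : w ∈ parabolic b I) : inv b J w = inv b I w := by
  refine (Finset.sum_subset (posFinset_mono hIJ) fun β hJ hI => negInd_of_isPos ?_).symm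
  rw [mem_posFinset] at hI hJ
  exact isPos_smul_of_not_supportedOn hw hJ.1 fun h => hI ⟨hJ.1, h⟩

theorem length_of_mem_parabolic {I : Set b.support} {w : P.weylGroup}
    (hw : w ∈ parabolic b I) : (length b w : ℤ) = inv b I w := by
  rw [length_eq_inv, inv_of_subset_of_mem_parabolic (Set.subset_univ I) hw]

/-- `y` permutes the positive roots outside the span of `I`, which gives the inversions of `v`; on
the span of `I` the element `v` changes no sign, which leaves the inversions of `y`. -/
theorem length_mul_of_isPos {I : Set b.support} {v y : P.weylGroup}
    (hv : ∀ i ∈ I, b.IsPos (v • (i : ι))) (hy : y ∈ parabolic b I) :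
    length b (v * y) = length b v + length b y := by
  classical
  have hsub := posFinset_mono (Set.subset_univ I)
  zify
  rw [length_eq_inv, length_eq_inv v, length_of_mem_parabolic hy]
  simp only [inv]
  rw [← Finset.sum_sdiff hsub, ← Finset.sum_sdiff hsub (f := fun β => negInd b (v • β))]
  simp only [mul_smul]
  rw [sum_posFinset_sdiff_smul (Set.subset_univ I) hy fun β => negInd b (v • β)]
  have h1 : ∑ β ∈ posFinset b I, negInd b (v • β) = 0 :=
    inv_eq_zero_of_isPos fun β hβ => by
      rw [mem_posFinset] at hβ
      exact (isPos_smul_of_forall_simple hv hβ.2).mpr hβ.1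
  have h2 : ∑ β ∈ posFinset b I, negInd b (v • y • β) = ∑ β ∈ posFinset b I, negInd b (y • β) :=
    Finset.sum_congr rfl fun β hβ => negInd_congr <|
      isPos_smul_of_forall_simple hv ((supportedOn_smul_iff hy).mpr (mem_posFinset.mp hβ).2)
  rw [h1, h2, add_zero]

end

section

variable {ι K M N : Type*} [Fintype ι] [Field K] [CharZero K]
  [AddCommGroup M] [Module K M] [AddCommGroup N] [Module K N]
  {P : RootPairing ι K M N} (b : P.Base)

variable {b} [P.IsCrystallographic] [P.IsReduced]

/-! ### The decomposition of a Weyl group element along a chain of parabolic subgroups -/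

/-- Otherwise `v s_i` would be a shorter element of the same coset. -/
theorem isPos_smul_of_mem_minReps {I J : Set b.support} {v : P.weylGroup}
    (hv : v ∈ minReps b J I) {i : b.support} (hi : i ∈ I) : b.IsPos (v • (i : ι)) := by
  by_contra h
  have h1 := inv_mul_refl_simple (Set.mem_univ i) v
  have h2 := hv.2 _ (refl_mem_parabolic hi)
  zify at h2
  rw [length_eq_inv, length_eq_inv, h1, negInd_of_not_isPos h] at h2
  linarith

theorem exists_mem_minReps_mul {I J : Set b.support} (hIJ : I ⊆ J) {w : P.weylGroup}
    (hw : w ∈ parabolic b J) : ∃ v ∈ minReps b J I, ∃ y ∈ parabolic b I, v * y = w := by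
  let f : parabolic b I → ℕ := fun y => length b (w * y)
  let y := Function.argmin f
  refine ⟨w * y, ⟨mul_mem hw (parabolic_mono hIJ y.2), fun z hz => ?_⟩, (y : P.weylGroup)⁻¹,
    inv_mem y.2, mul_inv_cancel_right _ _⟩
  have h := Function.argmin_le f (y * ⟨z, hz⟩)
  simpa [f, mul_assoc] using h

/-- The product `v (n - 1) * ⋯ * v 0`. -/
def cumProd (v : ℕ → P.weylGroup) : ℕ → P.weylGroup
  | 0 => 1
  | n + 1 => v n * cumProd v n

theorem cumProd_congr {v v' : ℕ → P.weylGroup} {n : ℕ} (h : ∀ k < n, v k = v' k) :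
    cumProd v n = cumProd v' n := by
  induction n with
  | zero => rfl
  | succ n ih =>
    rw [cumProd, cumProd, h n n.lt_succ_self, ih fun k hk => h k (hk.trans n.lt_succ_self)]

theorem reverse_ofFn_prod (v : ℕ → P.weylGroup) (n : ℕ) :
    (List.ofFn fun k : Fin n => v k).reverse.prod = cumProd v n := by
  induction n with
  | zero => simp [cumProd]
  | succ n ih =>
    rw [List.ofFn_succ', List.concat_eq_append, List.reverse_append, List.prod_append]
    simp [cumProd, ih]

variable {r : ℕ} (a : Fin r ↪ b.support)

theorem chain_zero : chain a 0 = ∅ := by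
  simp [chain]

theorem chain_of_lt {j : ℕ} (h : r < j) : chain a j = Set.univ := by
  simp [chain, h]

theorem chain_mono {j k : ℕ} (h : j ≤ k) : chain a j ⊆ chain a k := by
  rintro i (hi | ⟨s, hs, rfl⟩)
  · exact Or.inl (hi.trans_le h)
  · exact Or.inr ⟨s, hs.trans_le h, rfl⟩

variable {a}

theorem cumProd_mem_parabolic {v : ℕ → P.weylGroup} {n : ℕ}
    (hv : ∀ k < n, v k ∈ minReps b (chain a (k + 1)) (chain a k)) :
    cumProd v n ∈ parabolic b (chain a n) := by
  induction n with
  | zero => exact one_mem _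
  | succ n ih =>
    exact mul_mem (hv n n.lt_succ_self).1 (parabolic_mono (chain_mono a n.le_succ)
      (ih fun k hk => hv k (hk.trans n.lt_succ_self)))

theorem isPos_cumProd_smul_iff {v : ℕ → P.weylGroup} {m n : ℕ} (hmn : m ≤ n)
    (hv : ∀ k < n, v k ∈ minReps b (chain a (k + 1)) (chain a k)) {β : ι}
    (hβ : SupportedOn b (chain a m) β) :
    b.IsPos (cumProd v n • β) ↔ b.IsPos (cumProd v m • β) := by
  induction n, hmn using Nat.le_induction with
  | base => rfl
  | succ n hmn ih =>
    have hv' : ∀ k < n, v k ∈ minReps b (chain a (k + 1)) (chain a k) :=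
      fun k hk => hv k (hk.trans n.lt_succ_self)
    rw [← ih hv', cumProd, mul_smul]
    exact isPos_smul_of_forall_simple (fun _ => isPos_smul_of_mem_minReps (hv n n.lt_succ_self))
      ((supportedOn_smul_iff (cumProd_mem_parabolic hv')).mpr (hβ.mono (chain_mono a hmn)))

/-- The factors with index at least `m` change no sign of a root that comes from `Δ_m`, so only the
product of the first `m` factors matters. -/
theorem inv_cumProd {v : ℕ → P.weylGroup} {m n : ℕ} (hmn : m ≤ n)
    (hv : ∀ k < n, v k ∈ minReps b (chain a (k + 1)) (chain a k)) :
    inv b (chain a m) (cumProd v n) = length b (cumProd v m) := by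
  rw [length_of_mem_parabolic (cumProd_mem_parabolic fun k hk => hv k (hk.trans_le hmn))]
  exact Finset.sum_congr rfl fun β hβ =>
    negInd_congr (isPos_cumProd_smul_iff hmn hv (mem_posFinset.mp hβ).2)

theorem exists_cumProd_eq {n : ℕ} {w : P.weylGroup} (hw : w ∈ parabolic b (chain a n)) :
    ∃ v : ℕ → P.weylGroup, (∀ k < n, v k ∈ minReps b (chain a (k + 1)) (chain a k)) ∧
      cumProd v n = w := by
  induction n generalizing w with
  | zero =>
    rw [chain_zero, parabolic_empty, Subgroup.mem_bot] at hw
    exact ⟨1, by simp, hw.symm⟩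
  | succ n ih =>
    obtain ⟨x, hx, y, hy, rfl⟩ := exists_mem_minReps_mul (chain_mono a n.le_succ) hw
    obtain ⟨v, hv, rfl⟩ := ih hy
    refine ⟨Function.update v n x, fun k hk => ?_, ?_⟩
    · rcases Nat.lt_succ_iff_lt_or_eq.mp hk with h | rfl
      · rw [Function.update_of_ne h.ne]; exact hv k h
      · rw [Function.update_self]; exact hx
    · rw [cumProd, Function.update_self]
      congr 1
      exact cumProd_congr fun k hk => Function.update_of_ne hk.ne _ _

variable (a)

theorem decomposition_spec (w : P.weylGroup) : IsDecomposition a w (decomposition a w) := by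
  refine Classical.epsilon_spec (p := IsDecomposition a w) ?_
  have hw : w ∈ parabolic b (chain a (r + 1)) := by
    rw [chain_of_lt a r.lt_succ_self, parabolic_univ]; trivial
  obtain ⟨v, hv, h⟩ := exists_cumProd_eq hw
  exact ⟨fun k => v k, fun k => hv k k.isLt, by rw [reverse_ofFn_prod, h]⟩

/-- The two inversion counts are the lengths of consecutive partial products, which differ by the
length of one factor. -/
theorem grW_apply (w : P.weylGroup) (k : Fin (r + 1)) :
    grW a w k = inv b (chain a (k + 1)) w - inv b (chain a k) w := by
  obtain ⟨hd, hprod⟩ := decomposition_spec a w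
  -- The value `1` from index `r + 1` on is a filler that is never used.
  let v : ℕ → P.weylGroup := fun n => if h : n < r + 1 then decomposition a w ⟨n, h⟩ else 1
  have hvk (k : Fin (r + 1)) : v k = decomposition a w k := dif_pos k.isLt
  have hv : ∀ k < r + 1, v k ∈ minReps b (chain a (k + 1)) (chain a k) := fun k hk => by
    rw [hvk ⟨k, hk⟩]; exact hd ⟨k, hk⟩
  have hw : cumProd v (r + 1) = w := by
    rw [← reverse_ofFn_prod, ← hprod]
    simp only [hvk]
  rw [← hw, inv_cumProd k.isLt hv, inv_cumProd k.isLt.le hv, hw, cumProd, length_mul_of_isPos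
    (fun _ => isPos_smul_of_mem_minReps (hv k k.isLt))
    (cumProd_mem_parabolic fun j hj => hv j (hj.trans k.isLt)), hvk]
  simp [grW]

end

section

variable {ι K M N : Type*} [Fintype ι] [Field K] [CharZero K]
  [AddCommGroup M] [Module K M] [AddCommGroup N] [Module K N]
  {P : RootPairing ι K M N} (b : P.Base)

variable {b} [P.IsCrystallographic]

/-! ### Evaluating roots on the coroot lattice -/

theorem pair_root_eq (β : ι) (x : CorootLattice P) :
    pair P (P.root β) (x : N) = (P.root'In ℤ β x : K) :=
  (P.algebraMap_root'In_apply ℤ β x).symm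

theorem root'In_of_eq_add_zsmul {i j k : ι} {z : ℤ} (h : P.root k = P.root i + z • P.root j)
    (x : CorootLattice P) :
    P.root'In ℤ k x = P.root'In ℤ i x + z * P.root'In ℤ j x := by
  have h' : (P.root'In ℤ k x : K) = P.root'In ℤ i x + z * P.root'In ℤ j x := by
    rw [← pair_root_eq, ← pair_root_eq, ← pair_root_eq, pair, h]
    simp [pair]
  exact_mod_cast h'

theorem root'In_eq_sum_coeff (β : ι) (x : CorootLattice P) :
    P.root'In ℤ β x = ∑ j, coeff b β j * P.root'In ℤ (j : ι) x := by
  have h : (P.root'In ℤ β x : K) = ∑ j, (coeff b β j : K) * (P.root'In ℤ (j : ι) x : K) := by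
    rw [← pair_root_eq, pair, root_eq_sum_coeff b β]
    simp [← pair_root_eq, pair]
  exact_mod_cast h

theorem root'In_refl_smul (γ β : ι) (x : CorootLattice P) :
    P.root'In ℤ (refl P γ • β) x =
      P.root'In ℤ β x - P.pairingIn ℤ β γ * P.root'In ℤ γ x := by
  rw [root'In_of_eq_add_zsmul (root_refl_smul γ β)]; ring

theorem root'In_refl_self_smul (β : ι) (x : CorootLattice P) :
    P.root'In ℤ (refl P β • β) x = -P.root'In ℤ β x := by
  rw [root'In_refl_smul, P.pairingIn_same]; ring

theorem pairingIn_refl_smul (γ β : ι) :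
    P.pairingIn ℤ (refl P γ • β) γ = -P.pairingIn ℤ β γ := by
  have h := root'In_refl_smul γ β (corootElt P γ)
  simp only [P.root'In_corootSpanMem_eq_pairingIn, P.pairingIn_same] at h
  linarith

theorem pairingIn_refl_self_smul (β γ : ι) :
    P.pairingIn ℤ (refl P β • β) γ = -P.pairingIn ℤ β γ :=
  root'In_refl_self_smul β (corootElt P γ)

theorem corootBasis_eq (i : b.support) : corootBasis b i = corootElt P (i : ι) :=
  Subtype.ext (corootBasis_apply b i)

variable (b) in
/-- The pairing of an element of the coroot lattice with the sum of the positive roots supported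
on `I`. -/
def sumPos (I : Set b.support) : CorootLattice P →ₗ[ℤ] ℤ := ∑ β ∈ posFinset b I, P.root'In ℤ β

theorem sumPos_apply (I : Set b.support) (x : CorootLattice P) :
    sumPos b I x = ∑ β ∈ posFinset b I, P.root'In ℤ β x := by
  simp [sumPos]

theorem sumPos_empty : sumPos b ∅ = 0 := by
  refine Finset.sum_eq_zero fun β hβ => ?_
  obtain ⟨j, hj⟩ := exists_coeff_ne_zero b β
  exact absurd ((mem_posFinset.mp hβ).2 j (by simp)) hj

section Reduced

variable [P.IsReduced]

/-- `s_i` permutes the positive roots of `I` other than `α_i` and negates their pairings with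
`α_i^∨`, so these sum to zero; `⟨α_i, α_i^∨⟩ = 2` remains. -/
theorem sumPos_corootBasis {I : Set b.support} {i : b.support} (hi : i ∈ I) :
    sumPos b I (corootBasis b i) = 2 := by
  classical
  have h := sum_posFinset_erase_refl_smul hi fun β => P.pairingIn ℤ β (i : ι)
  simp only [pairingIn_refl_smul, Finset.sum_neg_distrib] at h
  rw [sumPos_apply, ← Finset.add_sum_erase _ _ (simple_mem_posFinset hi)]
  simp only [corootBasis_eq, P.root'In_corootSpanMem_eq_pairingIn, P.pairingIn_same]
  linarith

theorem sumPos_of_mem_subLattice {I J : Set b.support} (hIJ : I ⊆ J) {x : CorootLattice P}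
    (hx : x ∈ subLattice b I) : sumPos b J x = sumPos b I x := by
  refine LinearMap.eqOn_span (f := sumPos b J) (g := sumPos b I) ?_ hx
  rintro - ⟨i, hi, rfl⟩
  rw [sumPos_corootBasis hi, sumPos_corootBasis (hIJ hi)]

end Reduced

/-! ### Positive roots and a reflection -/

open Classical in
theorem sum_filter_isPos_refl_smul {I : Set b.support} {γ : ι} (hγ : SupportedOn b I γ)
    {A : Type*} [AddCommMonoid A] (f : ι → A) :
    ∑ β ∈ posFinset b I with b.IsPos (refl P γ • β), f (refl P γ • β) =
      ∑ β ∈ posFinset b I with b.IsPos (refl P γ • β), f β := by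
  have key (β : ι) (hβ : β ∈ {β ∈ posFinset b I | b.IsPos (refl P γ • β)}) :
      refl P γ • β ∈ {β ∈ posFinset b I | b.IsPos (refl P γ • β)} := by
    simp only [Finset.mem_filter, mem_posFinset] at *
    exact ⟨⟨hβ.2, (supportedOn_refl_smul hγ).mpr hβ.1.2⟩, by
      rw [refl_smul_refl_smul]; exact hβ.1.1⟩
  exact Finset.sum_nbij' (refl P γ • ·) (refl P γ • ·) key key
    (fun _ _ => refl_smul_refl_smul _ _) (fun _ _ => refl_smul_refl_smul _ _) fun _ _ => rfl

theorem pairingIn_pos_of_not_isPos {γ β : ι} (hγ : b.IsPos γ) (hβ : b.IsPos β)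
    (h : ¬ b.IsPos (refl P γ • β)) : 0 < P.pairingIn ℤ β γ := by
  by_contra hc
  exact h (isPos_of_eq_add_zsmul (root_refl_smul γ β) hβ hγ (by linarith))

open Classical in
-- The positive roots that `s_γ` keeps positive are permuted by it while their pairings with `γ^∨`
-- change sign, so they cancel. All remaining pairings are positive when `γ` is.
theorem sumPos_corootElt {I : Set b.support} {γ : ι} (hγ : SupportedOn b I γ) :
    sumPos b I (corootElt P γ) =
      ∑ β ∈ posFinset b I with ¬ b.IsPos (refl P γ • β), P.pairingIn ℤ β γ := by
  have h := sum_filter_isPos_refl_smul hγ fun β => P.pairingIn ℤ β γ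
  simp only [pairingIn_refl_smul, Finset.sum_neg_distrib] at h
  rw [sumPos_apply, ← Finset.sum_filter_add_sum_filter_not _ fun β => b.IsPos (refl P γ • β)]
  simp only [P.root'In_corootSpanMem_eq_pairingIn]
  linarith

theorem sumPos_corootElt_pos {I : Set b.support} {γ : ι} (hγ : γ ∈ posFinset b I) :
    0 < sumPos b I (corootElt P γ) := by
  classical
  rw [mem_posFinset] at hγ
  rw [sumPos_corootElt hγ.2]
  refine Finset.sum_pos (fun β hβ => ?_) ⟨γ, ?_⟩
  · simp only [Finset.mem_filter, mem_posFinset] at hβ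
    exact pairingIn_pos_of_not_isPos hγ.1 hβ.1.1 hβ.2
  · simp [mem_posFinset, hγ, isPos_refl_self_smul]

open Classical in
theorem sum_supportedOn (I : Set b.support) {f : ι → ℤ} (hf : ∀ β, f (refl P β • β) = f β) :
    ∑ β with SupportedOn b I β, f β = 2 * ∑ β ∈ posFinset b I, f β := by
  have hneg (β : ι) : refl P (refl P β • β) • refl P β • β = β := by
    apply P.root.injective
    rw [root_refl_self_smul, root_refl_self_smul, neg_neg]
  rw [← Finset.sum_filter_add_sum_filter_not _ b.IsPos, Finset.filter_filter, two_mul]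
  congr 1
  · refine Finset.sum_congr (Finset.ext fun β => ?_) fun _ _ => rfl
    simp [mem_posFinset, and_comm]
  · refine Finset.sum_nbij' (fun β => refl P β • β) (fun β => refl P β • β) (fun β hβ => ?_)
      (fun β hβ => ?_) (fun β _ => hneg β) (fun β _ => hneg β) fun β _ => (hf β).symm
    · simp only [Finset.mem_filter, Finset.mem_univ, true_and] at hβ
      rw [mem_posFinset, isPos_refl_self_smul, supportedOn_refl_self]
      exact hβ.symm
    · rw [mem_posFinset] at hβ
      simp only [Finset.mem_filter, Finset.mem_univ, true_and, isPos_refl_self_smul,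
        supportedOn_refl_self, not_not]
      exact hβ.symm

/-- Evaluates the cross term of the quadratic function minimized in `exists_lift`. It expresses the
invariance under `s_γ` of the sum over all roots in the span of `I`. -/
theorem two_mul_sum_root'In_mul_pairingIn {I : Set b.support} {γ : ι} (hγ : SupportedOn b I γ)
    (x : CorootLattice P) :
    2 * ∑ β ∈ posFinset b I, P.root'In ℤ β x * P.pairingIn ℤ β γ =
      P.root'In ℤ γ x * ∑ β ∈ posFinset b I, P.pairingIn ℤ β γ ^ 2 := by
  classical
  have h1 := sum_supportedOn I (f := fun β => P.root'In ℤ β x * P.pairingIn ℤ β γ) fun β => by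
    rw [root'In_refl_self_smul, pairingIn_refl_self_smul]; ring
  have h2 := sum_supportedOn I (f := fun β => P.pairingIn ℤ β γ ^ 2) fun β => by
    rw [pairingIn_refl_self_smul]; ring
  -- Substitute `s_γ β` for `β`, which negates `⟨β, γ^∨⟩` and changes `⟨β, x⟩` by `-⟨β, γ^∨⟩⟨γ, x⟩`.
  have h3 : ∑ β with SupportedOn b I β, P.root'In ℤ β x * P.pairingIn ℤ β γ =
      ∑ β with SupportedOn b I β, (P.root'In ℤ γ x * P.pairingIn ℤ β γ ^ 2 -
        P.root'In ℤ β x * P.pairingIn ℤ β γ) := by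
    refine Finset.sum_nbij' (refl P γ • ·) (refl P γ • ·) (fun β hβ => ?_) (fun β hβ => ?_)
      (fun _ _ => refl_smul_refl_smul _ _) (fun _ _ => refl_smul_refl_smul _ _) fun β _ => ?_
    · simpa [supportedOn_refl_smul hγ] using hβ
    · simpa [supportedOn_refl_smul hγ] using hβ
    · rw [root'In_refl_smul, pairingIn_refl_smul]; ring
  rw [Finset.sum_sub_distrib, ← Finset.mul_sum, h1, h2] at h3
  linarith

/-! ### Coefficients of coroots -/

section RootSystem

variable [P.IsRootSystem]

theorem intCast_corootBasis_repr (x : CorootLattice P) (i : b.support) :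
    ((corootBasis b).repr x i : K) = b.toCoweightBasis.repr (x : N) i := by
  classical
  have h : (x : N) = ∑ j, ((corootBasis b).repr x j : K) • b.toCoweightBasis j := by
    have h' := congrArg Subtype.val ((corootBasis b).sum_repr x)
    rw [← h', Submodule.coe_sum]
    refine Finset.sum_congr rfl fun j _ => ?_
    rw [b.toCoweightBasis_apply, ← corootBasis_apply, Int.cast_smul_eq_zsmul]
    rfl
  rw [h, map_sum, Finsupp.finsetSum_apply]
  simp [Finsupp.single_apply]

/-- The canonical invariant form carries each root to a nonzero multiple of its coroot, so expanding
`γ` in simple roots also expands `γ^∨` in simple coroots, with proportional factors at each place.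
-/
theorem toCoweightBasis_repr_coroot_eq_zero {γ : ι} {i : b.support} (h : coeff b γ i = 0) :
    b.toCoweightBasis.repr (P.coroot γ) i = 0 := by
  classical
  have hsum : P.RootForm (P.root γ) (P.root γ) • P.coroot γ =
      ∑ j, ((coeff b γ j : K) * P.RootForm (P.root (j : ι)) (P.root (j : ι))) •
        b.toCoweightBasis j := by
    rw [P.rootForm_self_smul_coroot, root_eq_sum_coeff b γ, map_sum, Finset.smul_sum]
    refine Finset.sum_congr rfl fun j _ => ?_
    rw [b.toCoweightBasis_apply, mul_smul, P.rootForm_self_smul_coroot, map_zsmul,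
      Int.cast_smul_eq_zsmul, smul_comm]
  have h' := congrArg (fun y => b.toCoweightBasis.repr y i) hsum
  simp only [map_smul, map_sum, Finsupp.finsetSum_apply, Finsupp.smul_apply,
    Module.Basis.repr_self, Finsupp.single_apply, smul_eq_mul, mul_ite, mul_one, mul_zero,
    Finset.sum_ite_eq', Finset.mem_univ, if_true, h, Int.cast_zero, zero_mul] at h'
  exact (mul_eq_zero.mp h').resolve_left
    (RootPairing.IsAnisotropic.rootForm_root_ne_zero γ)

theorem coeff_ne_zero_of_pair_fundamentalWeight {γ : ι} {i : b.support}
    (h : pair P (fundamentalWeight b i) (P.coroot γ) ≠ 0) : coeff b γ i ≠ 0 := by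
  refine fun hc => h ?_
  rw [pair, fundamentalWeight, LinearMap.apply_symm_toPerfPair_self, Module.Basis.coord_apply]
  exact toCoweightBasis_repr_coroot_eq_zero hc

theorem corootElt_mem_subLattice {I : Set b.support} {γ : ι} (hγ : SupportedOn b I γ) :
    corootElt P γ ∈ subLattice b I := by
  rw [subLattice, Module.Basis.mem_span_image]
  intro i hi
  by_contra hi'
  refine Finsupp.mem_support_iff.mp hi ?_
  have h := intCast_corootBasis_repr (b := b) (corootElt P γ) i
  rw [toCoweightBasis_repr_coroot_eq_zero (hγ i hi')] at h
  exact_mod_cast h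

end RootSystem

end

section

variable {ι K M N : Type*} [Fintype ι] [Field K] [CharZero K]
  [AddCommGroup M] [Module K M] [AddCommGroup N] [Module K N]
  {P : RootPairing ι K M N} (b : P.Base)

variable {b} [P.IsCrystallographic]

/-! ### Existence of lifts -/

theorem sum_root'In_add_smul_corootElt {I : Set b.support} {γ : ι} (hγ : SupportedOn b I γ)
    (x : CorootLattice P) (t : ℤ) :
    ∑ β ∈ posFinset b I, P.root'In ℤ β (x + t • corootElt P γ) *
        (P.root'In ℤ β (x + t • corootElt P γ) + 1) =
      ∑ β ∈ posFinset b I, P.root'In ℤ β x * (P.root'In ℤ β x + 1) +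
        t * sumPos b I (corootElt P γ) +
        t * (P.root'In ℤ γ x + t) * ∑ β ∈ posFinset b I, P.pairingIn ℤ β γ ^ 2 := by
  have h := two_mul_sum_root'In_mul_pairingIn hγ x
  rw [mul_add t, add_mul, mul_assoc t, ← h, sumPos_apply]
  simp only [Finset.mul_sum, ← Finset.sum_add_distrib]
  refine Finset.sum_congr rfl fun β _ => ?_
  simp only [map_add, map_zsmul, P.root'In_corootSpanMem_eq_pairingIn, smul_eq_mul]
  ring

/-- An integer is at most its square, strictly so for `⟨γ, γ^∨⟩ = 2`. -/
theorem sumPos_corootElt_lt_sum_sq {I : Set b.support} {γ : ι} (hγ : γ ∈ posFinset b I) :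
    sumPos b I (corootElt P γ) < ∑ β ∈ posFinset b I, P.pairingIn ℤ β γ ^ 2 := by
  rw [sumPos_apply]
  refine Finset.sum_lt_sum (fun β _ => ?_) ⟨γ, hγ, ?_⟩
  · rw [P.root'In_corootSpanMem_eq_pairingIn]
    exact Int.le_self_sq _
  · rw [P.root'In_corootSpanMem_eq_pairingIn, P.pairingIn_same]
    norm_num

variable [P.IsRootSystem]

/-- Minimize over the class the sum of `n (n + 1)` for `n = ⟨β, x⟩`. Each term is nonnegative and
vanishes exactly for `n ∈ {0, -1}`; any other value at some `β` could be improved by adding or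
subtracting `β^∨`. -/
theorem exists_lift (I : Set b.support) (c : CorootLattice P ⧸ subLattice b I) :
    ∃ x : CorootLattice P, Submodule.Quotient.mk x = c ∧
      ∀ β ∈ posFinset b I, P.root'In ℤ β x = 0 ∨ P.root'In ℤ β x = -1 := by
  let Φ : CorootLattice P → ℤ :=
    fun x => ∑ β ∈ posFinset b I, P.root'In ℤ β x * (P.root'In ℤ β x + 1)
  have hΦ (x : CorootLattice P) : 0 ≤ Φ x := Finset.sum_nonneg fun β _ => by
    rcases le_or_gt 0 (P.root'In ℤ β x) with h | h
    · positivity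
    · exact mul_nonneg_of_nonpos_of_nonpos h.le (by omega)
  let S : Set (CorootLattice P) := {x | Submodule.Quotient.mk x = c}
  have hS : S.Nonempty := Submodule.Quotient.mk_surjective _ c
  let f : CorootLattice P → ℕ := fun x => (Φ x).toNat
  let x := Function.argminOn f S hS
  have hx : Submodule.Quotient.mk x = c := Function.argminOn_mem f S hS
  refine ⟨x, hx, fun β hβ => ?_⟩
  have hβ' := (mem_posFinset.mp hβ).2
  have hmin (t : ℤ) : Φ x ≤ Φ (x + t • corootElt P β) := by
    have hy : x + t • corootElt P β ∈ S := by
      change Submodule.Quotient.mk _ = c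
      rw [← hx, Submodule.Quotient.eq, add_sub_cancel_left]
      exact Submodule.smul_mem _ _ (corootElt_mem_subLattice hβ')
    have h : f x ≤ f (x + t • corootElt P β) := Function.argminOn_le f S hy
    have h1 := hΦ x
    have h2 := hΦ (x + t • corootElt P β)
    simp only [f] at h
    omega
  -- With `s = sumPos b I (β^∨)`, `S = ∑ ⟨δ, β^∨⟩²` and `n = ⟨β, x⟩`, adding `t β^∨` changes the sum
  -- by `t s + t (n + t) S`, where `0 < s < S`. This is negative at `t = 1` if `n ≤ -2`, and at `t =
  -- -1` if `n ≥ 1`.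
  have h1 := hmin 1
  have h2 := hmin (-1)
  simp only [Φ, sum_root'In_add_smul_corootElt hβ'] at h1 h2
  have h3 := sumPos_corootElt_lt_sum_sq hβ
  have h4 := sumPos_corootElt_pos hβ
  rcases lt_trichotomy (P.root'In ℤ β x) 0 with h | h | h
  · right
    by_contra hne
    have h5 : P.root'In ℤ β x ≤ -2 := by omega
    nlinarith
  · exact Or.inl h
  · nlinarith

theorem lift_spec (I : Set b.support) (c : CorootLattice P ⧸ subLattice b I) :
    Submodule.Quotient.mk (lift b I c) = c ∧
      ∀ β ∈ posFinset b I, P.root'In ℤ β (lift b I c) = 0 ∨ P.root'In ℤ β (lift b I c) = -1 := by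
  have hiff (x : CorootLattice P) (β : ι) :
      (pair P (P.root β) (x : N) = 0 ∨ pair P (P.root β) (x : N) = -1) ↔
        (P.root'In ℤ β x = 0 ∨ P.root'In ℤ β x = -1) := by
    rw [pair_root_eq]; norm_cast
  have h : Submodule.Quotient.mk (lift b I c) = c ∧ ∀ β ∈ posRoots b I,
      pair P (P.root β) (lift b I c : N) = 0 ∨ pair P (P.root β) (lift b I c : N) = -1 :=
    Classical.epsilon_spec (p := fun x : CorootLattice P => Submodule.Quotient.mk x = c ∧
      ∀ β ∈ posRoots b I, pair P (P.root β) (x : N) = 0 ∨ pair P (P.root β) (x : N) = -1)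
      (by simpa only [hiff, mem_posRoots] using exists_lift I c)
  simpa only [hiff, mem_posRoots] using h

theorem mem_orthogonal {I : Set b.support} {x : CorootLattice P} {i : b.support} :
    i ∈ orthogonal b I x ↔ i ∈ I ∧ P.root'In ℤ (i : ι) x = 0 := by
  rw [orthogonal, Set.mem_ofPred_eq, pair_root_eq, Int.cast_eq_zero]

/-! ### Longest elements -/

variable [P.IsReduced]

theorem length_le_card (w : P.weylGroup) : length b w ≤ Fintype.card ι := by
  zify
  rw [length_eq_inv]
  calc inv b Set.univ w ≤ ∑ β ∈ posFinset b Set.univ, 1 :=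
        Finset.sum_le_sum fun β _ => negInd_le_one _
    _ ≤ Fintype.card ι := by
        rw [Finset.sum_const, nsmul_eq_mul, mul_one]
        exact_mod_cast Finset.card_le_univ _

theorem longest_spec (I : Set b.support) :
    longest b I ∈ parabolic b I ∧ ∀ v ∈ parabolic b I, length b v ≤ length b (longest b I) := by
  refine Classical.epsilon_spec
    (p := fun w => w ∈ parabolic b I ∧ ∀ v ∈ parabolic b I, length b v ≤ length b w) ?_
  have hbdd : BddAbove (length b '' (parabolic b I : Set P.weylGroup)) := by
    refine ⟨Fintype.card ι, ?_⟩
    rintro - ⟨w, -, rfl⟩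
    exact length_le_card w
  obtain ⟨w, hw, h⟩ := Nat.sSup_mem
    (s := length b '' (parabolic b I : Set P.weylGroup)) ⟨_, 1, one_mem (parabolic b I), rfl⟩ hbdd
  refine ⟨w, hw, fun v hv => ?_⟩
  rw [h]
  exact le_csSup hbdd ⟨v, hv, rfl⟩

theorem not_isPos_longest_smul {I : Set b.support} {β : ι} (hβ : β ∈ posFinset b I) :
    ¬ b.IsPos (longest b I • β) := by
  refine not_isPos_smul_of_forall_simple (fun i hi h => ?_) hβ
  have h1 := inv_mul_refl_simple (Set.mem_univ i) (longest b I)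
  have h2 := (longest_spec I).2 _ (mul_mem (longest_spec I).1 (refl_mem_parabolic hi))
  zify at h2
  rw [length_eq_inv, length_eq_inv, h1, negInd_of_isPos h] at h2
  linarith

theorem longest_smul_isPos {I : Set b.support} {β : ι} (hβ : SupportedOn b I β)
    (h : ¬ b.IsPos β) : b.IsPos (longest b I • β) := by
  have h' := not_isPos_longest_smul (mem_posFinset.mpr
    ⟨(isPos_refl_self_smul b β).mpr h, supportedOn_refl_self.mpr hβ⟩)
  rwa [smul_refl_self_smul, isPos_refl_self_smul, not_not] at h'

/-! ### The Peterson--Woodward lifting of a simple coroot -/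

variable {r : ℕ} (a : Fin r ↪ b.support)

theorem simpleLift_snd_sub_mem (α : b.support) :
    (simpleLift a α).2 - corootBasis b α ∈ subLattice b (chain a (stage a α)) := by
  rw [corootBasis_eq, ← Submodule.Quotient.eq]
  exact (lift_spec _ _).1

theorem orthogonal_subset (I : Set b.support) (x : CorootLattice P) : orthogonal b I x ⊆ I :=
  fun _ h => h.1

theorem simpleLift_fst_mem (α : b.support) :
    (simpleLift a α).1 ∈ parabolic b (chain a (stage a α)) :=
  mul_mem (mul_mem (one_mem _) (longest_spec _).1)
    (parabolic_mono (orthogonal_subset _ _) (longest_spec _).1)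

/-- A positive root in the span of `I'` is made negative by `ω_{I'}` and positive again by `ω_I`;
any other positive root of `I` stays positive under `ω_{I'}` and is then made negative by `ω_I`. The
first kind consists of the roots on which the lift vanishes. -/
theorem negInd_simpleLift_smul (α : b.support) {β : ι}
    (hβ : β ∈ posFinset b (chain a (stage a α))) :
    negInd b ((simpleLift a α).1 • β) = -P.root'In ℤ β (simpleLift a α).2 := by
  set I := chain a (stage a α)
  set x := (simpleLift a α).2
  have hx : ∀ β ∈ posFinset b I, P.root'In ℤ β x = 0 ∨ P.root'In ℤ β x = -1 := (lift_spec _ _).2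
  have hw : (simpleLift a α).1 • β = longest b I • longest b (orthogonal b I x) • β := by
    rw [smul_smul]
    change (1 * longest b I * longest b (orthogonal b I x)) • β = _
    rw [one_mul]
  have hO := (longest_spec (orthogonal b I x)).1
  have hβ' := mem_posFinset.mp hβ
  have hsupp := (supportedOn_smul_iff (parabolic_mono (orthogonal_subset I x) hO)).mpr hβ'.2
  rw [hw]
  by_cases h : SupportedOn b (orthogonal b I x) β
  · rw [negInd_of_isPos (longest_smul_isPos hsupp
      (not_isPos_longest_smul (mem_posFinset.mpr ⟨hβ'.1, h⟩))), root'In_eq_sum_coeff (b := b),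
      Finset.sum_eq_zero, neg_zero]
    intro j _
    by_cases hj : j ∈ orthogonal b I x
    · rw [(mem_orthogonal.mp hj).2, mul_zero]
    · rw [h j hj, zero_mul]
  · rw [negInd_of_not_isPos (not_isPos_longest_smul (mem_posFinset.mpr
      ⟨isPos_smul_of_not_supportedOn hO hβ'.1 h, hsupp⟩))]
    rcases hx β hβ with h0 | h0
    -- The value on `β` is a sum of nonpositive terms, one for each simple root. If it is zero then
    -- every term is, so `β` involves only simple roots on which the lift vanishes.
    · exfalso
      refine h fun j hj => ?_
      by_cases hjI : j ∈ I
      · rw [root'In_eq_sum_coeff (b := b)] at h0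
        have hle (j : b.support) : coeff b β j * P.root'In ℤ (j : ι) x ≤ 0 := by
          by_cases hjI : j ∈ I
          · refine mul_nonpos_of_nonneg_of_nonpos (coeff_nonneg hβ'.1 j) ?_
            rcases hx j (simple_mem_posFinset hjI) with h | h <;> rw [h]; norm_num
          · rw [hβ'.2 j hjI, zero_mul]
        have h1 := (Finset.sum_eq_zero_iff_of_nonpos fun j _ => hle j).mp h0 j (Finset.mem_univ j)
        exact (mul_eq_zero.mp h1).resolve_right fun h2 => hj (mem_orthogonal.mpr ⟨hjI, h2⟩)
      · exact hβ'.2 j hjI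
    · rw [h0]; norm_num

theorem inv_simpleLift_of_le (α : b.support) {m : ℕ} (hm : m ≤ stage a α) :
    inv b (chain a m) (simpleLift a α).1 = -sumPos b (chain a m) (simpleLift a α).2 := by
  rw [inv, sumPos_apply, ← Finset.sum_neg_distrib]
  exact Finset.sum_congr rfl fun β hβ =>
    negInd_simpleLift_smul a α (posFinset_mono (chain_mono a hm) hβ)

theorem inv_simpleLift_of_ge (α : b.support) {m : ℕ} (hm : (stage a α : ℕ) ≤ m) :
    inv b (chain a m) (simpleLift a α).1 =
      -sumPos b (chain a (stage a α)) (simpleLift a α).2 := by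
  rw [inv_of_subset_of_mem_parabolic (chain_mono a hm) (simpleLift_fst_mem a α),
    inv_simpleLift_of_le a α le_rfl]

/-! ### The grading -/

/-- Turns the sums over `i ≤ j` in the recursion for `gr(q_{α^∨})` into values of linear forms on
`λ' - α^∨`, which lies in the span of `α_1^∨, …, α_j^∨`. -/
theorem sum_repr_simpleLift (α : b.support) (f : CorootLattice P →ₗ[ℤ] ℤ) :
    ∑ i : Fin (stage a α : ℕ), (corootBasis b).repr (simpleLift a α).2
        (a (i.castLE (Nat.lt_succ_iff.mp (stage a α).isLt))) *
          f (corootBasis b (a (i.castLE (Nat.lt_succ_iff.mp (stage a α).isLt)))) =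
      f ((simpleLift a α).2 - corootBasis b α) := by
  set d := (simpleLift a α).2 - corootBasis b α with hd
  have hmem : d ∈ subLattice b (chain a (stage a α)) := simpleLift_snd_sub_mem a α
  rw [subLattice, Module.Basis.mem_span_image] at hmem
  have hle : (stage a α : ℕ) ≤ r := Nat.lt_succ_iff.mp (stage a α).isLt
  have hfd : f d = ∑ s, (corootBasis b).repr d s * f (corootBasis b s) := by
    conv_lhs => rw [← (corootBasis b).sum_repr d]
    simp
  rw [hfd]
  refine Finset.sum_of_injOn (fun i : Fin (stage a α : ℕ) => a (i.castLE hle))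
    (fun i _ j _ h => Fin.castLE_injective hle (a.injective h))
    (fun _ _ => Finset.mem_coe.mpr (Finset.mem_univ _)) (fun s _ hs => ?_) fun i _ => ?_
  · have h0 : (corootBasis b).repr d s = 0 := by
      by_contra hne
      -- The first alternative in `chain` would say `r < stage a α`, which is impossible.
      rcases hmem (Finsupp.mem_support_iff.mpr hne) with h | ⟨k, hk, rfl⟩
      · omega
      · exact hs ⟨⟨k, hk⟩, by simp, rfl⟩
    rw [h0, zero_mul]
  · have hne : α ≠ a (i.castLE hle) := by
      intro h
      refine (stage_spec a α).2 (Or.inr ⟨i.castLE hle, i.isLt, h.symm⟩)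
    rw [hd, map_sub, Module.Basis.repr_self, Finsupp.sub_apply, Finsupp.single_eq_of_ne hne.symm,
      sub_zero]

theorem chain_stage_mem {α : b.support} {m : ℕ} (h : (stage a α : ℕ) < m) : α ∈ chain a m :=
  chain_mono a h (stage_spec a α).1

/-- By induction on the stage, the recursion becomes linear in `λ' - α^∨`, and the inversion counts
of `x` are minus the pairings of `λ'`. -/
theorem grQ_apply (α : b.support) (k : Fin (r + 1)) :
    grQ a α k = sumPos b (chain a (k + 1)) (corootBasis b α) -
      sumPos b (chain a k) (corootBasis b α) := by
  induction hn : (stage a α : ℕ) using Nat.strong_induction_on generalizing α k with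
  | _ n ih =>
  subst hn
  have hle : (stage a α : ℕ) ≤ r := Nat.lt_succ_iff.mp (stage a α).isLt
  have ih' (i : Fin (stage a α : ℕ)) := ih _ (by rw [stage_apply]; exact i.isLt)
    (a (i.castLE hle)) k rfl
  have hd := simpleLift_snd_sub_mem a α
  have h2 := sum_repr_simpleLift a α (sumPos b (chain a (stage a α)))
  have h3 := sum_repr_simpleLift a α (sumPos b (chain a (k + 1)) - sumPos b (chain a k))
  have h4 : ∑ i : Fin (stage a α : ℕ), 2 * (corootBasis b).repr (simpleLift a α).2
      (a (i.castLE hle)) =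
        sumPos b (chain a (stage a α)) ((simpleLift a α).2 - corootBasis b α) := by
    rw [← h2]
    refine Finset.sum_congr rfl fun i _ => ?_
    rw [sumPos_corootBasis (Or.inr ⟨_, i.isLt, rfl⟩), mul_comm]
  have hlen : (length b (simpleLift a α).1 : ℤ) =
      -sumPos b (chain a (stage a α)) (simpleLift a α).2 := by
    rw [length_of_mem_parabolic (simpleLift_fst_mem a α), inv_simpleLift_of_le a α le_rfl]
  rw [grQ, h4, hlen]
  simp only [Pi.sub_apply, Pi.smul_apply, Finset.sum_apply, smul_eq_mul, ih', grW_apply]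
  simp only [LinearMap.sub_apply] at h3
  rw [h3]
  have hbig {m : ℕ} (hm : (stage a α : ℕ) ≤ m) :=
    sumPos_of_mem_subLattice (chain_mono a hm) hd
  have htwo {m : ℕ} (hm : (stage a α : ℕ) < m) :=
    sumPos_corootBasis (chain_stage_mem a hm)
  -- Below the stage, `gr(x)` cancels the contribution of `λ'`. At the stage, the coefficient of
  -- `e_{j+1}` supplies the remaining terms. Above it, `x` has no new inversions, `λ' - α^∨` has
  -- constant pairing, and both sides vanish because `sumPos` is `2` on `α^∨` at both ends.
  rcases lt_trichotomy k (stage a α) with h | h | h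
  · rw [Pi.single_eq_of_ne h.ne, inv_simpleLift_of_le a α h, inv_simpleLift_of_le a α h.le]
    simp only [map_sub]
    ring
  · rw [h, Pi.single_eq_same, inv_simpleLift_of_le a α le_rfl,
      inv_simpleLift_of_ge a α (Nat.le_succ _), hbig (Nat.le_succ _), htwo (Nat.lt_succ_self _)]
    simp only [map_sub]
    ring
  · have h' : (stage a α : ℕ) < k := h
    rw [Pi.single_eq_of_ne h.ne', inv_simpleLift_of_ge a α (h'.le.trans (Nat.le_succ _)),
      inv_simpleLift_of_ge a α h'.le, hbig h'.le, hbig (h'.le.trans (Nat.le_succ _)), htwo h',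
      htwo (h'.trans (Nat.lt_succ_self _))]
    ring

theorem gr_apply (w : P.weylGroup) (x : CorootLattice P) (k : Fin (r + 1)) :
    ofLex (gr a w x) k = (inv b (chain a (k + 1)) w + sumPos b (chain a (k + 1)) x) -
      (inv b (chain a k) w + sumPos b (chain a k) x) := by
  have hx (f : CorootLattice P →ₗ[ℤ] ℤ) :
      f x = ∑ s, (corootBasis b).repr x s * f (corootBasis b s) := by
    conv_lhs => rw [← (corootBasis b).sum_repr x]
    simp
  have h := hx (sumPos b (chain a (k + 1)) - sumPos b (chain a k))
  simp only [LinearMap.sub_apply] at h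
  change grW a w k + (∑ s, (corootBasis b).repr x s • grQ a s) k = _
  rw [Finset.sum_apply]
  simp only [Pi.smul_apply, smul_eq_mul, grQ_apply, grW_apply]
  rw [← h]
  ring

end

section

variable {ι K M N : Type*} [Fintype ι] [Field K] [CharZero K]
  [AddCommGroup M] [Module K M] [AddCommGroup N] [Module K N]
  {P : RootPairing ι K M N} (b : P.Base)

/-! ### Comparing partial sums -/

/-- At the first coordinate where `x` and `y` differ, the preceding partial sums agree, so the
inequality of the next ones decides the comparison. -/
theorem toLex_le_of_partial_sums {n : ℕ} {x y : Lex (Fin n → ℤ)} {F G : ℕ → ℤ} (h0 : F 0 = G 0)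
    (hx : ∀ k : Fin n, ofLex x k = F (k + 1) - F k) (hy : ∀ k : Fin n, ofLex y k = G (k + 1) - G k)
    (h : ∀ m, F m ≤ G m) : x ≤ y := by
  by_contra hlt
  obtain ⟨k, hk, hlt⟩ : ∃ k, (∀ j < k, ofLex y j = ofLex x j) ∧ ofLex y k < ofLex x k :=
    not_le.mp hlt
  have heq (m : ℕ) (hm : m ≤ k) : F m = G m := by
    induction m with
    | zero => exact h0
    | succ m ih =>
      have h1 := hk ⟨m, hm.trans k.isLt.le⟩ hm
      rw [hx, hy] at h1
      have h2 := ih (Nat.le_of_succ_le hm)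
      simp only at h1
      linarith
  rw [hx, hy, heq k le_rfl] at hlt
  linarith [h (k + 1)]

variable {b}

theorem inv_empty (w : P.weylGroup) : inv b ∅ w = 0 := by
  refine Finset.sum_eq_zero fun β hβ => ?_
  obtain ⟨j, hj⟩ := exists_coeff_ne_zero b β
  exact absurd ((mem_posFinset.mp hβ).2 j (by simp)) hj

variable [P.IsCrystallographic]

/-! ### Inversions and multiplication by a reflection -/

/-- `s_γ` fixes coefficients outside `I`, so it permutes the positive roots not supported on `I`,
whose contribution to the difference is therefore zero. -/
theorem inv_mul_refl_sub {I : Set b.support} {γ : ι} (hγ : SupportedOn b I γ)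
    (u : P.weylGroup) :
    inv b I (u * refl P γ) - inv b I u =
      inv b Set.univ (u * refl P γ) - inv b Set.univ u := by
  classical
  have hsub := posFinset_mono (Set.subset_univ I)
  have hmem (β : ι) (hβ : β ∈ posFinset b Set.univ \ posFinset b I) :
      refl P γ • β ∈ posFinset b Set.univ \ posFinset b I := by
    simp only [Finset.mem_sdiff, mem_posFinset_univ, mem_posFinset (I := I), not_and] at *
    have hβI := hβ.2 hβ.1
    obtain ⟨j, hj, hne⟩ : ∃ j, j ∉ I ∧ coeff b β j ≠ 0 := by simpa [SupportedOn] using hβI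
    have hpos := lt_of_le_of_ne (coeff_nonneg hβ.1 j) hne.symm
    refine ⟨isPos_of_coeff_pos (s := j) ?_, fun _ => mt (supportedOn_refl_smul hγ).mp hβI⟩
    rwa [coeff_of_eq_add_zsmul b (root_refl_smul γ β), hγ j hj, mul_zero, add_zero]
  have h : ∑ β ∈ posFinset b Set.univ \ posFinset b I, negInd b (u • refl P γ • β) =
      ∑ β ∈ posFinset b Set.univ \ posFinset b I, negInd b (u • β) :=
    Finset.sum_nbij' (refl P γ • ·) (refl P γ • ·) hmem hmem
      (fun _ _ => refl_smul_refl_smul _ _) (fun _ _ => refl_smul_refl_smul _ _) fun _ _ => rfl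
  simp only [inv, mul_smul]
  rw [← Finset.sum_sdiff hsub, ← Finset.sum_sdiff hsub (f := fun β => negInd b (u • β)), h]
  ring

open Classical in
theorem inv_univ_mul_refl (u : P.weylGroup) (γ : ι) :
    inv b Set.univ (u * refl P γ) - inv b Set.univ u =
      ∑ β ∈ posFinset b Set.univ with ¬ b.IsPos (refl P γ • β),
        (negInd b (u • refl P γ • β) - negInd b (u • β)) := by
  have h := sum_filter_isPos_refl_smul (b := b) (I := Set.univ) (γ := γ)
    (fun _ hj => absurd trivial hj) fun β => negInd b (u • β)
  simp only [inv, mul_smul]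
  rw [← Finset.sum_sub_distrib,
    ← Finset.sum_filter_add_sum_filter_not _ fun β => b.IsPos (refl P γ • β),
    Finset.sum_sub_distrib, h, sub_self, zero_add]

theorem root_smul_refl_smul (u : P.weylGroup) (γ β : ι) :
    P.root (u • refl P γ • β) = P.root (u • β) + (-P.pairingIn ℤ β γ) • P.root (u • γ) :=
  root_smul_of_eq_add_zsmul u (root_refl_smul γ β)

/-- Over the set `D` of positive roots made negative by `s_γ`, the changes `t β` are nonnegative and
sum to `1`. Since `γ` already contributes `1`, the rest vanish, and `γ` itself does not occur in
`I`. -/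
theorem inv_mul_refl_le {I : Set b.support} {γ : ι} (hγ : b.IsPos γ) (hI : ¬ SupportedOn b I γ)
    {u : P.weylGroup} (h : inv b Set.univ (u * refl P γ) = inv b Set.univ u + 1) :
    inv b I (u * refl P γ) ≤ inv b I u := by
  classical
  let D : Finset ι := {β ∈ posFinset b Set.univ | ¬ b.IsPos (refl P γ • β)}
  let t : ι → ℤ := fun β => negInd b (u • refl P γ • β) - negInd b (u • β)
  have hmemD {β : ι} : β ∈ D ↔ b.IsPos β ∧ ¬ b.IsPos (refl P γ • β) := by
    rw [Finset.mem_filter, mem_posFinset_univ]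
  have hsum : ∑ β ∈ D, t β = 1 := by
    rw [← inv_univ_mul_refl]; linarith
  have hc {β : ι} (hβ : β ∈ D) : 0 < P.pairingIn ℤ β γ :=
    pairingIn_pos_of_not_isPos hγ (hmemD.mp hβ).1 (hmemD.mp hβ).2
  -- If `u γ` were negative, `u s_γ β` would be `u β` plus a positive multiple of a positive root
  -- for each `β ∈ D`, and no change could be positive.
  have huγ : b.IsPos (u • γ) := by
    by_contra hn
    have hle : ∑ β ∈ D, t β ≤ 0 := Finset.sum_nonpos fun β hβ => by
      by_cases hp : b.IsPos (u • β)
      · have hroot : P.root (u • refl P γ • β) =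
            P.root (u • β) + P.pairingIn ℤ β γ • P.root (refl P (u • γ) • u • γ) := by
          rw [root_smul_refl_smul, root_refl_self_smul, neg_smul, smul_neg]
        have := isPos_of_eq_add_zsmul hroot hp ((isPos_refl_self_smul b _).mpr hn) (hc hβ).le
        simp only [t, negInd_of_isPos hp, negInd_of_isPos this, sub_self, le_refl]
      · simp only [t, negInd_of_not_isPos hp]
        linarith [negInd_le_one (b := b) (u • refl P γ • β)]
    omega
  have ht {β : ι} (hβ : β ∈ D) : 0 ≤ t β := by
    by_cases hp : b.IsPos (u • refl P γ • β)
    · have hroot : P.root (u • β) =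
          P.root (u • refl P γ • β) + P.pairingIn ℤ β γ • P.root (u • γ) := by
        rw [root_smul_refl_smul, neg_smul, neg_add_cancel_right]
      have := isPos_of_eq_add_zsmul hroot hp huγ (hc hβ).le
      simp only [t, negInd_of_isPos hp, negInd_of_isPos this, sub_self, le_refl]
    · simp only [t, negInd_of_not_isPos hp]
      linarith [negInd_le_one (b := b) (u • β)]
  have hγD : γ ∈ D := hmemD.mpr ⟨hγ, by rwa [isPos_refl_self_smul, not_not]⟩
  have htγ : t γ = 1 := by
    simp only [t, negInd_smul_refl_self, negInd_of_isPos huγ, sub_zero]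
  have hzero : ∀ β ∈ D.erase γ, t β = 0 := by
    refine (Finset.sum_eq_zero_iff_of_nonneg fun β hβ => ht (Finset.mem_of_mem_erase hβ)).mp ?_
    have := Finset.add_sum_erase D t hγD
    linarith
  refine Finset.sum_le_sum fun β hβ => ?_
  rw [mem_posFinset] at hβ
  rw [mul_smul, ← sub_nonpos]
  change t β ≤ 0
  by_cases hD : b.IsPos (refl P γ • β)
  · have hle : P.pairingIn ℤ β γ ≤ 0 := by
      by_contra hc
      exact hI (supportedOn_of_pairing_pos hγ hβ.2 hD (not_le.mp hc))
    by_cases hp : b.IsPos (u • β)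
    · have := isPos_of_eq_add_zsmul (root_smul_refl_smul u γ β) hp huγ (neg_nonneg.mpr hle)
      simp only [t, negInd_of_isPos hp, negInd_of_isPos this, sub_self, le_refl]
    · simp only [t, negInd_of_not_isPos hp]
      linarith [negInd_le_one (b := b) (u • refl P γ • β)]
  · have hne : β ≠ γ := fun hne => hI (hne ▸ hβ.2)
    exact (hzero β (Finset.mem_erase.mpr ⟨hne, hmemD.mpr ⟨hβ.1, hD⟩⟩)).le

/-- The same scheme with `⟨β, γ^∨⟩` added to each change. On `D` the pairing is at least `1` and the
sign change at least `-1`, so all terms are nonnegative; `γ` contributes at least `2 - 1`, which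
exhausts the total `1`. -/
theorem inv_mul_refl_add_sumPos_le {I : Set b.support} {γ : ι} (hγ : b.IsPos γ)
    (hI : ¬ SupportedOn b I γ) {u : P.weylGroup}
    (h : inv b Set.univ (u * refl P γ) + sumPos b Set.univ (corootElt P γ) =
      inv b Set.univ u + 1) :
    inv b I (u * refl P γ) + sumPos b I (corootElt P γ) ≤ inv b I u := by
  classical
  let D : Finset ι := {β ∈ posFinset b Set.univ | ¬ b.IsPos (refl P γ • β)}
  let t : ι → ℤ :=
    fun β => negInd b (u • refl P γ • β) - negInd b (u • β) + P.pairingIn ℤ β γ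
  have hmemD {β : ι} : β ∈ D ↔ b.IsPos β ∧ ¬ b.IsPos (refl P γ • β) := by
    rw [Finset.mem_filter, mem_posFinset_univ]
  have hsum : ∑ β ∈ D, t β = 1 := by
    have h1 := sumPos_corootElt (b := b) (I := Set.univ) (γ := γ) fun _ hj => absurd trivial hj
    rw [Finset.sum_add_distrib, ← inv_univ_mul_refl, ← h1]
    linarith
  have hbound (β : ι) : -1 ≤ negInd b (u • refl P γ • β) - negInd b (u • β) ∧
      negInd b (u • refl P γ • β) - negInd b (u • β) ≤ 1 := by
    have h1 := negInd_le_one (b := b) (u • β)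
    have h2 := negInd_le_one (b := b) (u • refl P γ • β)
    have h3 := negInd_nonneg (b := b) (u • β)
    have h4 := negInd_nonneg (b := b) (u • refl P γ • β)
    constructor <;> linarith
  have ht {β : ι} (hβ : β ∈ D) : 0 ≤ t β := by
    have hc := pairingIn_pos_of_not_isPos hγ (hmemD.mp hβ).1 (hmemD.mp hβ).2
    have := (hbound β).1
    simp only [t]
    omega
  have hγD : γ ∈ D := hmemD.mpr ⟨hγ, by rwa [isPos_refl_self_smul, not_not]⟩
  have htγ : 1 ≤ t γ := by
    have := (hbound γ).1
    simp only [t, P.pairingIn_same]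
    linarith
  have hzero : ∀ β ∈ D.erase γ, t β = 0 := by
    have hnonneg : ∀ β ∈ D.erase γ, 0 ≤ t β := fun β hβ => ht (Finset.mem_of_mem_erase hβ)
    refine (Finset.sum_eq_zero_iff_of_nonneg hnonneg).mp ?_
    have h1 := Finset.add_sum_erase D t hγD
    have h2 := Finset.sum_nonneg hnonneg
    linarith
  rw [← sub_nonpos, inv, inv, sumPos_apply, ← Finset.sum_add_distrib, ← Finset.sum_sub_distrib]
  refine Finset.sum_nonpos fun β hβ => ?_
  rw [mem_posFinset] at hβ
  rw [mul_smul, P.root'In_corootSpanMem_eq_pairingIn, add_sub_right_comm]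
  change t β ≤ 0
  by_cases hD : b.IsPos (refl P γ • β)
  · have hle : P.pairingIn ℤ β γ ≤ 0 := by
      by_contra hc
      exact hI (supportedOn_of_pairing_pos hγ hβ.2 hD (not_le.mp hc))
    -- A pairing of at most `-1` outweighs a sign change of at most `1`; a zero pairing means that
    -- `s_γ` fixes `β`.
    rcases hle.lt_or_eq with hlt | h0
    · have := (hbound β).2
      simp only [t]
      omega
    · have hfix : refl P γ • β = β := by
        apply P.root.injective
        rw [root_refl_smul, h0, neg_zero, zero_smul, add_zero]
      simp only [t, hfix, h0, sub_self, add_zero, le_refl]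
  · have hne : β ≠ γ := fun hne => hI (hne ▸ hβ.2)
    exact (hzero β (Finset.mem_erase.mpr ⟨hne, hmemD.mpr ⟨hβ.1, hD⟩⟩)).le

/-! ### Reduction of the Key Lemma to inequalities for each set of simple roots -/

theorem pair_twoRho (γ : ι) :
    pair P (twoRho b) (P.coroot γ) = (sumPos b Set.univ (corootElt P γ) : K) := by
  classical
  rw [pair, twoRho, map_sum, LinearMap.sum_apply, sumPos_apply, Int.cast_sum]
  refine Finset.sum_congr (Finset.ext fun β => ?_) fun β _ => pair_root_eq β (corootElt P γ)
  simp [mem_posFinset_univ]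

variable [P.IsReduced] [P.IsRootSystem]

theorem inv_refl_simple {I : Set b.support} {i : b.support} (hi : i ∈ I) :
    inv b I (refl P (i : ι)) = 1 := by
  have h := inv_mul_refl_simple hi 1
  rwa [one_mul, inv_one, one_smul, negInd_of_isPos (isPos_simple b i)] at h

theorem gr_le_of_forall_inv_le {r : ℕ} (a : Fin r ↪ b.support) {w u s : P.weylGroup}
    {x : CorootLattice P}
    (h : ∀ I : Set b.support, inv b I w + sumPos b I x ≤ inv b I u + inv b I s) :
    gr a w x ≤ gr a u 0 + gr a s 0 := by
  refine toLex_le_of_partial_sums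
    (F := fun m => inv b (chain a m) w + sumPos b (chain a m) x)
    (G := fun m => inv b (chain a m) u + inv b (chain a m) s) ?_ (fun k => gr_apply a w x k)
    (fun k => ?_) fun m => h _
  · simp [chain_zero, inv_empty, sumPos_empty]
  · change ofLex (gr a u 0) k + ofLex (gr a s 0) k = _
    rw [gr_apply, gr_apply]
    simp only [map_zero]
    ring

end

end

end WeylGrading

theorem mainTheorem7 {ι K M N : Type*} [Fintype ι] [Field K] [CharZero K]
    [AddCommGroup M] [Module K M] [AddCommGroup N] [Module K N]
    (P : RootPairing ι K M N) [P.IsRootSystem] [P.IsCrystallographic] [P.IsReduced]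
    (b : P.Base) {r : ℕ} (a : Fin r ↪ b.support)
    (u : P.weylGroup) (γ : ι) (hγ : b.IsPos γ) (i : b.support)
    (hi : WeylGrading.pair P (WeylGrading.fundamentalWeight b i) (P.coroot γ) ≠ 0) :
    (WeylGrading.length b (u * WeylGrading.refl P γ) = WeylGrading.length b u + 1 →
      WeylGrading.gr a (u * WeylGrading.refl P γ) 0 ≤
        WeylGrading.gr a u 0 + WeylGrading.gr a (WeylGrading.refl P i) 0) ∧
    ((WeylGrading.length b (u * WeylGrading.refl P γ) : K) =
        WeylGrading.length b u + 1
          - WeylGrading.pair P (WeylGrading.twoRho b) (P.coroot γ) →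
      WeylGrading.gr a (u * WeylGrading.refl P γ) (WeylGrading.corootElt P γ) ≤
        WeylGrading.gr a u 0 + WeylGrading.gr a (WeylGrading.refl P i) 0) := by
  have hmem {I : Set b.support} (hI : WeylGrading.SupportedOn b I γ) :
      WeylGrading.inv b I (WeylGrading.refl P (i : ι)) = 1 := by
    -- If `γ` is supported on `I` then `α_i ∈ I`, because `α_i` occurs in `γ` whenever `α_i^∨`
    -- occurs in `γ^∨`.
    refine WeylGrading.inv_refl_simple ?_
    by_contra hiI
    exact WeylGrading.coeff_ne_zero_of_pair_fundamentalWeight hi (hI i hiI)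
  refine ⟨fun h => WeylGrading.gr_le_of_forall_inv_le a fun I => ?_,
    fun h => WeylGrading.gr_le_of_forall_inv_le a fun I => ?_⟩
  · zify at h
    rw [WeylGrading.length_eq_inv, WeylGrading.length_eq_inv] at h
    rw [map_zero, add_zero]
    by_cases hI : WeylGrading.SupportedOn b I γ
    · rw [hmem hI]
      linarith [WeylGrading.inv_mul_refl_sub hI u]
    · linarith [WeylGrading.inv_mul_refl_le hγ hI h,
        WeylGrading.inv_nonneg I (WeylGrading.refl P (i : ι))]
  · have h' : WeylGrading.inv b Set.univ (u * WeylGrading.refl P γ) +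
        WeylGrading.sumPos b Set.univ (WeylGrading.corootElt P γ) =
          WeylGrading.inv b Set.univ u + 1 := by
      rw [WeylGrading.pair_twoRho] at h
      rw [← WeylGrading.length_eq_inv, ← WeylGrading.length_eq_inv]
      have h'' : ((WeylGrading.length b (u * WeylGrading.refl P γ) : ℤ) : K) +
          (WeylGrading.sumPos b Set.univ (WeylGrading.corootElt P γ) : K) =
            ((WeylGrading.length b u : ℤ) : K) + 1 := by
        push_cast
        linear_combination h
      exact_mod_cast h''
    by_cases hI : WeylGrading.SupportedOn b I γ
    · have h1 := WeylGrading.sumPos_of_mem_subLattice (Set.subset_univ I)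
        (WeylGrading.corootElt_mem_subLattice hI)
      rw [hmem hI]
      linarith [WeylGrading.inv_mul_refl_sub hI u]
    · linarith [WeylGrading.inv_mul_refl_add_sumPos_le hγ hI h',
        WeylGrading.inv_nonneg I (WeylGrading.refl P (i : ι))]
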